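/- Let $k$ be a field. A $k$-functor is a functor from (commutative) $k$-algebras to sets; an abelian-group-valued $k$-functor is a functor from $k$-algebras to abelian groups, and these form an abelian category $\mathcal A$. For $F_1,F_2\in\mathcal A$, let $\operatorname{Ext}^1(F_1,F_2)$ be the group of isomorphism classes of extensions $0\to F_2\to F\to F_1\to 0$ in $\mathcal A$ (so exactness is exactness of the groups of values at each $k$-algebra), and let $\operatorname{Ext}^1_s(F_1,F_2)$ be the subgroup of the classes of those extensions for which $\pi\colon F\to F_1$ has a section $\sigma\colon F_1\to F$, $\pi\circ\sigma=1_{F_1}$, that is a morphism of (set-valued) $k$-functors. A functor $F\in\mathcal A$ is a sheaf if it is a sheaf for the fpqc topology, i.e. $F$ takes finite products of $k$-algebras to products (in particular $F(0)=0$) and for every faithfully flat homomorphism $B\to C$ of $k$-algebras the map from $F(B)$ to the equalizer of $F(C)\rightrightarrows F(C\otimes_B C)$ is bijective. $F$ is nilpotent if it is a sheaf and $F(B)=0$ for every reduced $k$-algebra $B$; subnilpotent if it admits a monomorphism in $\mathcal A$ to a nilpotent functor; discrete if it is isomorphic to the constant sheaf associated to some abelian group $A$, i.e. to $B\mapsto\{\text{locally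 constant functions } \operatorname{Spec}(B)\to A\}$; $\mathbb Z$ also denotes the constant sheaf associated to the group $\mathbb Z$, and $\mathbb G_m(B)=B^*$. For $\alpha\in\{0,1,2,\dots,\infty\}$ let $\mathbb G_a^{\alpha}(B)$ be the direct sum of $\alpha$ copies (countably many if $\alpha=\infty$) of the additive group of $B$. $F$ is strictly additive if $F\cong\mathbb G_a^\alpha$ in $\mathcal A$ for some such $\alpha$, and additive if it has a finite filtration $0=F_0\subset F_1\subset\dots\subset F_n=F$ in $\mathcal A$ with strictly additive successive quotients. Then: (a) If $W\to G$ is an epimorphism in $\mathcal A$ and $V$ is additive, then the induced map $\operatorname{Mor}_{k\text{-functors}}(V,W)\to\operatorname{Mor}_{k\text{-functors}}(V,G)$ (morphisms of set-valued functors) is surjective. (b) If $V$ is additive, then $\operatorname{Ext}^1_s(V,F)=\operatorname{Ext}^1(V,F)$ for all $F\in\mathcal A$. (c) If $F$ is a sheaf, then $\operatorname{Ext}^1(\mathbb Z,F)=0$. (d) If $0\to U_1\to U_2\to P\to 0$ is an exact sequence in $\mathcal A$ with $U_1$ and $U_2$ additive, then $\operatorname{Ext}^1(\mathbb G_m,P)=0$.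 (e) $\operatorname{Ext}^1(I,D)=0$ if $I$ is subnilpotent and $D$ is discrete. (f) $\operatorname{Ext}^1(U,V)=0$ if $U$ and $V$ are additive and $k$ has characteristic zero. -/

import Mathlib

open CategoryTheory CategoryTheory.Limits
open scoped TensorProduct

universe v u

/-! ### Yoneda extensions in an abelian category -/

section Extensions

variable {C : Type u} [Category.{v} C] [Abelian C]

/-- An extension `0 → F₂ → E → F₁ → 0` of `F₁` by `F₂`. -/
structure Extension (F₁ F₂ : C) where
  obj : C
  i : F₂ ⟶ obj
  p : obj ⟶ F₁
  zero : i ≫ p = 0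
  shortExact : (ShortComplex.mk i p zero).ShortExact

/-- Two extensions of `F₁` by `F₂` are isomorphic if there is an isomorphism of the middle terms
that is compatible with the maps from `F₂` and to `F₁`. -/
instance Extension.setoid (F₁ F₂ : C) : Setoid (Extension F₁ F₂) where
  r E E' := ∃ e : E.obj ≅ E'.obj, E.i ≫ e.hom = E'.i ∧ e.hom ≫ E'.p = E.p
  iseqv :=
    { refl := fun E => ⟨Iso.refl _, by simp, by simp⟩
      symm := by
        rintro E E' ⟨e, h₁, h₂⟩
        exact ⟨e.symm, by simp [← h₁], by simp [← h₂]⟩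
      trans := by
        rintro E E' E'' ⟨e, h₁, h₂⟩ ⟨e', h₁', h₂'⟩
        refine ⟨e ≪≫ e', ?_, ?_⟩
        · rw [Iso.trans_hom, ← Category.assoc, h₁, h₁']
        · rw [Iso.trans_hom, Category.assoc, h₂', h₂] }

/-- The trivial extension `0 → F₂ → F₂ ⊞ F₁ → F₁ → 0`. -/
noncomputable def Extension.trivial (F₁ F₂ : C) : Extension F₁ F₂ where
  obj := F₂ ⊞ F₁
  i := biprod.inl
  p := biprod.snd
  zero := by simp
  shortExact :=
    (ShortComplex.Splitting.mk (S := ShortComplex.mk (biprod.inl : F₂ ⟶ F₂ ⊞ F₁) biprod.snd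
      (by simp)) biprod.fst biprod.inr).shortExact

/-- `Ext¹(F₁, F₂)`: the isomorphism classes of extensions of `F₁` by `F₂`. -/
def ExtOne (F₁ F₂ : C) : Type (max u v) := Quotient (Extension.setoid F₁ F₂)

/-- The zero element of `Ext¹(F₁, F₂)` is the class of the trivial extension. -/
noncomputable instance (F₁ F₂ : C) : Zero (ExtOne F₁ F₂) :=
  ⟨Quotient.mk _ (Extension.trivial F₁ F₂)⟩

/-- `Ext¹(F₁, F₂) = 0`. -/
def ExtOneVanishes (F₁ F₂ : C) : Prop := ∀ x : ExtOne F₁ F₂, x = 0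

end Extensions

/-! ### Functors from `k`-algebras to abelian groups -/

section KFunctors

/-- The category of (abelian group)-valued `k`-functors. -/
abbrev AbKFunctor (k : Type u) [Field k] : Type (u + 1) := CommAlgCat.{u} k ⥤ AddCommGrpCat.{u}

variable {k : Type u} [Field k]

/-- The underlying (set-valued) `k`-functor. -/
abbrev AbKFunctor.toSet (F : AbKFunctor k) : CommAlgCat.{u} k ⥤ Type u :=
  F ⋙ forget AddCommGrpCat.{u}

/-- The morphism of underlying (set-valued) `k`-functors. -/
abbrev AbKFunctor.mapToSet {F G : AbKFunctor k} (π : F ⟶ G) : F.toSet ⟶ G.toSet :=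
  Functor.whiskerRight π (forget AddCommGrpCat.{u})

/-- An extension is set-theoretically split if its projection has a section in the category
of set-valued `k`-functors. -/
def Extension.IsSetSplit {F₁ F₂ : AbKFunctor k} (E : Extension F₁ F₂) : Prop :=
  ∃ σ : F₁.toSet ⟶ E.obj.toSet, σ ≫ AbKFunctor.mapToSet E.p = 𝟙 F₁.toSet

/-- `Ext¹ₛ(F₁, F₂)`, as a subset of `Ext¹(F₁, F₂)`: the classes of the set-theoretically split
extensions. -/
def extOneSetSplit (F₁ F₂ : AbKFunctor k) : Set (ExtOne F₁ F₂) :=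
  {x | ∃ E : Extension F₁ F₂, E.IsSetSplit ∧ Quotient.mk _ E = x}

/-- Sheaves for the fpqc topology: finite products of `k`-algebras (also the empty product, the
zero ring) go to products, and `F(B) → F(C) ⇉ F(C ⊗_B C)` is an equalizer for every
faithfully flat `B → C`. -/
structure AbKFunctor.IsFpqcSheaf (F : AbKFunctor k) : Prop where
  subsingleton : ∀ (B : Type u) [CommRing B] [Algebra k B], Subsingleton B →
    Subsingleton (F.obj (CommAlgCat.of k B))
  prod : ∀ (B C : Type u) [CommRing B] [Algebra k B] [CommRing C] [Algebra k C],
    Function.Bijective fun x : F.obj (CommAlgCat.of k (B × C)) =>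
      (F.map (CommAlgCat.ofHom (AlgHom.fst k B C)) x,
        F.map (CommAlgCat.ofHom (AlgHom.snd k B C)) x)
  descent : ∀ (B C : Type u) [CommRing B] [Algebra k B] [CommRing C] [Algebra k C]
    [Algebra B C] [IsScalarTower k B C], Module.FaithfullyFlat B C →
    Set.BijOn (F.map (CommAlgCat.ofHom (IsScalarTower.toAlgHom k B C))) Set.univ
      {x : F.obj (CommAlgCat.of k C) |
        F.map (CommAlgCat.ofHom
            (Algebra.TensorProduct.includeLeft : C →ₐ[k] C ⊗[B] C)) x =
          F.map (CommAlgCat.ofHom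
            ((Algebra.TensorProduct.includeRight : C →ₐ[B] C ⊗[B] C).restrictScalars k)) x}

/-- `𝔾ₐ^ι`, the direct sum of copies of `𝔾ₐ` indexed by `ι`: `B ↦ ⨁_{i ∈ ι} B`. -/
noncomputable def gaPow (k : Type u) [Field k] (ι : Type) : AbKFunctor k where
  obj B := AddCommGrpCat.of (ι →₀ B)
  map f := AddCommGrpCat.ofHom
    (Finsupp.mapRange.addMonoidHom (f.hom : _ →+ _))
  map_id B := by
    ext x : 2
    ext i
    simp
  map_comp f g := by
    ext x : 2
    ext i
    simp

/-- `𝔾ₘ`, that is `B ↦ Bˣ`, written additively. -/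
def gm (k : Type u) [Field k] : AbKFunctor k where
  obj B := AddCommGrpCat.of (Additive Bˣ)
  map f := AddCommGrpCat.ofHom (Units.map (f.hom : _ →* _)).toAdditive
  map_id _ := rfl
  map_comp _ _ := rfl

/-- The constant sheaf associated to the abelian group `A`: it sends `B` to the group of locally
constant functions `Spec B → A`. -/
def constSheaf (k : Type u) [Field k] (A : Type u) [AddCommGroup A] : AbKFunctor k where
  obj B := AddCommGrpCat.of (LocallyConstant (PrimeSpectrum B) A)
  map f := AddCommGrpCat.ofHom (LocallyConstant.comapAddMonoidHom
    ⟨PrimeSpectrum.comap (f.hom : _ →+* _), PrimeSpectrum.continuous_comap _⟩)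
  map_id _ := rfl
  map_comp _ _ := rfl

namespace AbKFunctor

/-- `F ≅ 𝔾ₐ^α` for some `α ∈ {0, 1, …, ∞}`, the cardinality of a countable index set. -/
def IsStrictlyAdditive (F : AbKFunctor k) : Prop :=
  ∃ (ι : Type) (_ : Countable ι), Nonempty (F ≅ gaPow k ι)

/-- `F` has a finite filtration `0 = F₀ ⊆ F₁ ⊆ ⋯ ⊆ Fₙ = F` with strictly additive successive
quotients. -/
def IsAdditive (F : AbKFunctor k) : Prop :=
  ∃ (n : ℕ) (s : ℕ → Subobject F), s 0 = ⊥ ∧ s n = ⊤ ∧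
    ∀ i < n, ∃ h : s i ≤ s (i + 1), IsStrictlyAdditive (cokernel (Subobject.ofLE _ _ h))

/-- `F` is a sheaf and vanishes on reduced `k`-algebras. -/
def IsNilpotent (F : AbKFunctor k) : Prop :=
  F.IsFpqcSheaf ∧ ∀ B : CommAlgCat.{u} k, IsReduced B → Subsingleton (F.obj B)

/-- `F` embeds into a nilpotent `k`-functor. -/
def IsSubnilpotent (F : AbKFunctor k) : Prop :=
  ∃ (N : AbKFunctor k) (j : F ⟶ N), Mono j ∧ N.IsNilpotent

/-- `F` is a constant sheaf. -/
def IsDiscrete (F : AbKFunctor k) : Prop :=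
  ∃ A : AddCommGrpCat.{u}, Nonempty (F ≅ constSheaf k A)

end AbKFunctor

end KFunctors

/-! ### Splittings of extensions -/

section Extensions

variable {C : Type u} [Category.{v} C] [Abelian C]

/-! Everything rests on Yoneda: an epimorphism in this category is surjective on every algebra, so a
natural map out of a representable set-valued functor lifts by lifting the value at the universal
point.

(a), (b): finite affine spaces are representable, and `𝔾ₐ^∞` is their increasing union;
independently chosen lifts on the finite stages are glued by a telescoping sum
(`exists_lift_gaPow`). An additive functor is, as a set-valued functor, a retract of a countable
`𝔾ₐ^ι`, hence inherits the lifting property. Lifting the identity gives (b).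

(c): choose `e ∈ E(k)` over `1`. On `k^J` with `J` finite, `E` is the product of its values at the
points, because the constant sheaf and `F` are. A locally constant integer function on `Spec B`
comes from a homomorphism `k^J → B`, so it lifts to the image of a family of multiples of `e`. Such
elements form a subgroup, natural in `B`, meeting the kernel of `E.p` trivially
(`IsLocallyMultiple.eq_zero`), so the lift is unique and thus additive and natural.

(d): a set-theoretic section over `𝔾ₘ` has a 2-cocycle as its defect. The constant term of a Laurent
polynomial is an invariant mean on `𝔾ₘ`, which kills the second and third Hochschild cohomology with
values in `𝔾ₐ^ι`, and by dévissage in any additive functor. Exactness of `H²(U₂) → H²(P) → H³(U₁)`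
then gives `H²(P) = 0`.

(e): `I` vanishes on reduced algebras and `D` does not see nilpotents, so `E(B) → E(B_red) =
D(B_red) = D(B)` is a retraction.

(f): in characteristic zero the doubling map separates weights: `2 - 2^n` is invertible for `n ≠ 1`.
A section can therefore be corrected until its failure to be additive is homogeneous of weight one
and zero on the axes, which forces it to vanish (`eq_zero_of_homogeneous`). Hence extensions between
powers of `𝔾ₐ` split, additive functors are strictly additive, and (f) follows. -/

theorem extOneVanishes_of_splitting {F₁ F₂ : C}
    (h : ∀ E : Extension F₁ F₂, Nonempty (ShortComplex.mk E.i E.p E.zero).Splitting) :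
    ExtOneVanishes F₁ F₂ := by
  intro x
  obtain ⟨E, rfl⟩ := Quotient.exists_rep x
  obtain ⟨s⟩ := h E
  refine Quotient.sound ⟨s.isoBinaryBiproduct, ?_, ?_⟩
  · have h₁ : E.i ≫ s.r = 𝟙 _ := s.f_r
    have h₂ : E.i ≫ E.p = 0 := E.zero
    apply biprod.hom_ext <;> simp [ShortComplex.Splitting.isoBinaryBiproduct, Extension.trivial,
      h₁, h₂]
  · simp [ShortComplex.Splitting.isoBinaryBiproduct, Extension.trivial]

theorem extOneVanishes_of_section {F₁ F₂ : C}
    (h : ∀ E : Extension F₁ F₂, ∃ s : F₁ ⟶ E.obj, s ≫ E.p = 𝟙 F₁) : ExtOneVanishes F₁ F₂ :=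
  extOneVanishes_of_splitting fun E =>
    let ⟨s, hs⟩ := h E
    ⟨.ofExactOfSection _ E.shortExact.exact s hs E.shortExact.mono_f⟩

theorem extOneVanishes_of_retraction {F₁ F₂ : C}
    (h : ∀ E : Extension F₁ F₂, ∃ r : E.obj ⟶ F₂, E.i ≫ r = 𝟙 F₂) : ExtOneVanishes F₁ F₂ :=
  extOneVanishes_of_splitting fun E =>
    let ⟨r, hr⟩ := h E
    ⟨.ofExactOfRetraction _ E.shortExact.exact r hr E.shortExact.epi_g⟩

theorem shortExact_cokernel {X Y : C} (f : X ⟶ Y) [Mono f] :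
    (ShortComplex.mk f (cokernel.π f) (cokernel.condition f)).ShortExact where
  exact := ShortComplex.exact_cokernel f
  mono_f := ‹_›
  epi_g := inferInstanceAs (Epi (cokernel.π f))

end Extensions

/-! ### Filtrations and short exact sequences, evaluated on algebras -/

namespace AbKFunctor

variable {k : Type u} [Field k]

/-- Induction along a filtration with strictly additive quotients. -/
theorem IsAdditive.induction {P : AbKFunctor k → Prop}
    (zero : ∀ Z : AbKFunctor k, IsZero Z → P Z)
    (iso : ∀ {F G : AbKFunctor k}, (F ≅ G) → P F → P G)
    (ext : ∀ S : ShortComplex (AbKFunctor k), S.ShortExact → P S.X₁ →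
      IsStrictlyAdditive S.X₃ → P S.X₂)
    {V : AbKFunctor k} (hV : V.IsAdditive) : P V := by
  obtain ⟨n, s, h0, hn, h⟩ := hV
  have key : ∀ i ≤ n, P (s i : AbKFunctor k) := by
    intro i
    induction i with
    | zero =>
      intro _
      rw [h0]
      exact zero _ ((isZero_zero _).of_iso Subobject.botCoeIsoZero)
    | succ i ih =>
      intro hi
      obtain ⟨hle, hs⟩ := h i (by omega)
      exact ext _ (shortExact_cokernel (Subobject.ofLE _ _ hle)) (ih (by omega)) hs
  have := key n le_rfl
  rw [hn] at this
  exact iso (asIso (⊤ : Subobject V).arrow) this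

variable {S : ShortComplex (AbKFunctor k)}

theorem shortExact_app (h : S.ShortExact) (B : CommAlgCat.{u} k) :
    (S.map ((evaluation _ _).obj B)).ShortExact := h.map_of_exact _

theorem app_injective (h : S.ShortExact) (B : CommAlgCat.{u} k) :
    Function.Injective (S.f.app B) :=
  (AddCommGrpCat.mono_iff_injective _).1 (shortExact_app h B).mono_f

theorem app_surjective_of_epi {W G : AbKFunctor k} (π : W ⟶ G) [Epi π] (B : CommAlgCat.{u} k) :
    Function.Surjective (π.app B) :=
  (AddCommGrpCat.epi_iff_surjective _).1 ((NatTrans.epi_iff_epi_app π).1 ‹_› B)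

theorem app_surjective (h : S.ShortExact) (B : CommAlgCat.{u} k) :
    Function.Surjective (S.g.app B) :=
  have := h.epi_g
  app_surjective_of_epi S.g B

theorem app_exact (h : S.ShortExact) {B : CommAlgCat.{u} k} {x : S.X₂.obj B}
    (hx : S.g.app B x = 0) : ∃ y, S.f.app B y = x :=
  ((ShortComplex.ab_exact_iff_function_exact _).1 (shortExact_app h B).exact x).1 hx

theorem app_comp_eq_zero (S : ShortComplex (AbKFunctor k)) {B : CommAlgCat.{u} k}
    (x : S.X₁.obj B) : S.g.app B (S.f.app B x) = 0 := by
  change (S.f ≫ S.g).app B x = 0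
  rw [S.zero]
  rfl

/-- The choice of preimages under a short exact sequence, for a family killed by `S.g`. -/
theorem exists_preimage_natural (h : S.ShortExact) {X : CommAlgCat.{u} k → Type*}
    (m : ∀ {B C : CommAlgCat.{u} k}, (B ⟶ C) → X B → X C) (f : ∀ B, X B → S.X₂.obj B)
    (hf : ∀ {B C : CommAlgCat.{u} k} (φ : B ⟶ C) x, f C (m φ x) = S.X₂.map φ (f B x))
    (hf0 : ∀ B x, S.g.app B (f B x) = 0) :
    ∃ g : ∀ B, X B → S.X₁.obj B,
      (∀ {B C : CommAlgCat.{u} k} (φ : B ⟶ C) x, g C (m φ x) = S.X₁.map φ (g B x)) ∧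
      ∀ B x, S.f.app B (g B x) = f B x := by
  choose g hg using fun B x => app_exact h (hf0 B x)
  refine ⟨g, fun {B C} φ x => ?_, hg⟩
  apply app_injective h
  rw [hg, NatTrans.naturality_apply, hg, hf]

/-- A natural family of homomorphisms. -/
def homMk {V W : AbKFunctor k} (f : ∀ B, V.obj B → W.obj B)
    (hadd : ∀ B x y, f B (x + y) = f B x + f B y)
    (hf : ∀ {B C : CommAlgCat.{u} k} (φ : B ⟶ C) x, f C (V.map φ x) = W.map φ (f B x)) :
    V ⟶ W where
  app B := AddCommGrpCat.ofHom (AddMonoidHom.mk' (f B) (hadd B))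
  naturality B C φ := by
    ext x
    exact hf φ x

/-- A natural family of maps of sets. -/
def setHomMk {V W : AbKFunctor k} (f : ∀ B, V.obj B → W.obj B)
    (hf : ∀ {B C : CommAlgCat.{u} k} (φ : B ⟶ C) x, f C (V.map φ x) = W.map φ (f B x)) :
    V.toSet ⟶ W.toSet where
  app B := TypeCat.ofHom (f B)
  naturality B C φ := by
    ext x
    exact hf φ x

theorem setHom_ext {V W : AbKFunctor k} {σ τ : V.toSet ⟶ W.toSet}
    (h : ∀ B (x : V.obj B), σ.app B x = τ.app B x) : σ = τ := by
  ext B x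
  exact h B x

theorem setHom_naturality {V W : AbKFunctor k} (σ : V.toSet ⟶ W.toSet)
    {B C : CommAlgCat.{u} k} (φ : B ⟶ C) (x : V.obj B) :
    (show W.obj C from σ.app C (V.map φ x)) = W.map φ (show W.obj B from σ.app B x) :=
  NatTrans.naturality_apply σ φ x

/-! ### Lifting maps out of additive functors -/

section Lift

variable {ι : Type} {W G : AbKFunctor k} (π : W ⟶ G) [Epi π]
  (τ : ∀ B : CommAlgCat.{u} k, (ι →₀ B) → G.obj B)
  (hτ : ∀ {B C : CommAlgCat.{u} k} (φ : B ⟶ C) (x : ι →₀ B),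
    τ C (x.mapRange φ.hom (map_zero φ.hom)) = G.map φ (τ B x))

include hτ

/-- Maps out of the affine space with finitely many coordinates lift, by representability. -/
theorem exists_lift_filter (S : Set ι) [DecidablePred (· ∈ S)] (hS : S.Finite) :
    ∃ σ : ∀ B : CommAlgCat.{u} k, (ι →₀ B) → W.obj B,
      (∀ {B C : CommAlgCat.{u} k} (φ : B ⟶ C) (x : ι →₀ B),
        σ C (x.mapRange φ.hom (map_zero φ.hom)) = W.map φ (σ B x)) ∧
      ∀ B x, π.app B (σ B x) = τ B (x.filter (· ∈ S)) := by
  classical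
  let A : CommAlgCat.{u} k := .of k (MvPolynomial ι k)
  -- The universal point with coordinates in `S`; finiteness of `S` gives it finite support.
  -- Evaluation at `x` sends it to the truncation of `x` to `S`.
  let ξ : ι →₀ A := Finsupp.onFinset hS.toFinset
    (fun i => if i ∈ S then (MvPolynomial.X i : MvPolynomial ι k) else 0)
    (by intro i hi; by_contra h; simp_all)
  obtain ⟨w, hw⟩ := app_surjective_of_epi π A (τ A ξ)
  let ev {B : CommAlgCat.{u} k} (x : ι →₀ B) : A ⟶ B := CommAlgCat.ofHom (MvPolynomial.aeval x)
  refine ⟨fun B x => W.map (ev x) w, fun {B C} φ x => ?_, fun B x => ?_⟩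
  · have : ev (x.mapRange φ.hom (map_zero φ.hom)) = ev x ≫ φ := by
      ext : 1
      apply MvPolynomial.algHom_ext
      intro i
      simp [ev]
    beta_reduce
    rw [this, Functor.map_comp]
    rfl
  · rw [NatTrans.naturality_apply, hw, ← hτ]
    congr 1
    ext i
    by_cases hi : i ∈ S
    · simp only [Finsupp.filter_apply, Finsupp.mapRange_apply, hi, if_true, ξ,
        Finsupp.onFinset_apply]
      exact MvPolynomial.aeval_X (R := k) x i
    · simp [ξ, ev, hi]

/-- Natural maps out of `𝔾ₐ^ι` lift along epimorphisms. -/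
theorem exists_lift_gaPow [Countable ι] :
    ∃ σ : ∀ B : CommAlgCat.{u} k, (ι →₀ B) → W.obj B,
      (∀ {B C : CommAlgCat.{u} k} (φ : B ⟶ C) (x : ι →₀ B),
        σ C (x.mapRange φ.hom (map_zero φ.hom)) = W.map φ (σ B x)) ∧
      ∀ B x, π.app B (σ B x) = τ B x := by
  classical
  obtain ⟨e, he⟩ := exists_injective_nat ι
  let S (n : ℕ) : Set ι := {i | e i < n}
  have hS (n : ℕ) : (S n).Finite := (Set.finite_Iio n).preimage he.injOn
  choose s hs hπ using fun n => exists_lift_filter π τ hτ (S n) (hS n)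
  let t {B : CommAlgCat.{u} k} (n : ℕ) (x : ι →₀ B) : ι →₀ B := x.filter (· ∈ S n)
  have ht {B C : CommAlgCat.{u} k} (φ : B ⟶ C) (n : ℕ) (x : ι →₀ B) :
      t n (x.mapRange φ.hom (map_zero φ.hom)) = (t n x).mapRange φ.hom (map_zero φ.hom) := by
    ext i
    by_cases hi : i ∈ S n <;> simp [t, hi]
  have htt {B : CommAlgCat.{u} k} (m n : ℕ) (h : n ≤ m) (x : ι →₀ B) : t m (t n x) = t n x := by
    ext i
    by_cases hi : i ∈ S n
    · have hi' : i ∈ S m := lt_of_lt_of_le hi h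
      simp [t, hi, hi']
    · by_cases hi' : i ∈ S m <;> simp [t, hi, hi']
  let N {B : CommAlgCat.{u} k} (x : ι →₀ B) : ℕ := x.support.sup (fun i => e i + 1)
  have hN {B : CommAlgCat.{u} k} (x : ι →₀ B) (n : ℕ) (hn : N x ≤ n) : t n x = x := by
    apply Finsupp.filter_eq_self_iff _ _ |>.2
    intro i hi
    have : e i + 1 ≤ N x :=
      Finset.le_sup (f := fun i => e i + 1) (Finsupp.mem_support_iff.2 hi)
    change e i < n
    omega
  -- The lifts `s n` need not be compatible. Using the same `s (n + 1)` in both terms makes `D n x`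
  -- vanish as soon as truncation at `n` does nothing to `x`, while its image under `π` is a term of
  -- a telescoping sum for `τ`.
  let D {B : CommAlgCat.{u} k} (n : ℕ) (x : ι →₀ B) : W.obj B :=
    s (n + 1) B (t (n + 1) x) - s (n + 1) B (t n x)
  have hD0 {B : CommAlgCat.{u} k} (x : ι →₀ B) (n : ℕ) (hn : n ≥ N x) : D n x = 0 := by
    simp only [D, hN x n hn, hN x (n + 1) (by omega), sub_self]
  have hDφ {B C : CommAlgCat.{u} k} (φ : B ⟶ C) (n : ℕ) (x : ι →₀ B) :
      D n (x.mapRange φ.hom (map_zero φ.hom)) = W.map φ (D n x) := by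
    simp only [D, ht, hs, map_sub]
  have hDπ {B : CommAlgCat.{u} k} (n : ℕ) (x : ι →₀ B) :
      π.app B (D n x) = τ B (t (n + 1) x) - τ B (t n x) := by
    have h₁ := htt (n + 1) (n + 1) le_rfl x
    have h₂ := htt (n + 1) n (by omega) x
    simp only [t] at h₁ h₂
    simp only [D, map_sub, hπ, t, h₁, h₂]
  refine ⟨fun B x => s 0 B 0 + ∑ n ∈ Finset.range (N x), D n x, fun {B C} φ x => ?_,
    fun B x => ?_⟩
  · have hle : N (x.mapRange φ.hom (map_zero φ.hom)) ≤ N x :=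
      Finset.sup_mono Finsupp.support_mapRange
    beta_reduce
    rw [← Finset.eventually_constant_sum (hD0 (x.mapRange φ.hom (map_zero φ.hom))) hle]
    simp only [hDφ, map_add, map_sum]
    congr 1
    rw [← hs]
    simp
  · have h0 : t 0 x = 0 := by
      ext i
      simp [t, S]
    beta_reduce
    rw [map_add, map_sum, Finset.sum_congr rfl fun n _ => hDπ n x]
    rw [Finset.sum_range_sub (fun n => τ B (t n x)), hN x _ le_rfl, h0, hπ,
      Finsupp.filter_zero]
    exact add_sub_cancel _ _

end Lift

/-- `V` is a retract of some countable `𝔾ₐ^ι` as a set-valued functor. -/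
def IsSetRetractOfGaPow (V : AbKFunctor k) : Prop :=
  ∃ (ι : Type) (_ : Countable ι) (j : ∀ B : CommAlgCat.{u} k, V.obj B → (ι →₀ B))
    (r : ∀ B : CommAlgCat.{u} k, (ι →₀ B) → V.obj B),
    (∀ {B C : CommAlgCat.{u} k} (φ : B ⟶ C) v,
      j C (V.map φ v) = (j B v).mapRange φ.hom (map_zero φ.hom)) ∧
    (∀ {B C : CommAlgCat.{u} k} (φ : B ⟶ C) (x : ι →₀ B),
      r C (x.mapRange φ.hom (map_zero φ.hom)) = V.map φ (r B x)) ∧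
    ∀ B v, r B (j B v) = v

theorem IsSetRetractOfGaPow.exists_lift {V W G : AbKFunctor k} (hV : V.IsSetRetractOfGaPow)
    (π : W ⟶ G) [Epi π] (τ : ∀ B : CommAlgCat.{u} k, V.obj B → G.obj B)
    (hτ : ∀ {B C : CommAlgCat.{u} k} (φ : B ⟶ C) x, τ C (V.map φ x) = G.map φ (τ B x)) :
    ∃ σ : ∀ B : CommAlgCat.{u} k, V.obj B → W.obj B,
      (∀ {B C : CommAlgCat.{u} k} (φ : B ⟶ C) x, σ C (V.map φ x) = W.map φ (σ B x)) ∧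
      ∀ B x, π.app B (σ B x) = τ B x := by
  obtain ⟨ι, _, j, r, hj, hr, hrj⟩ := hV
  obtain ⟨σ, hσ, hπ⟩ := exists_lift_gaPow π (fun B x => τ B (r B x))
    (fun φ x => by rw [hr, hτ])
  refine ⟨fun B v => σ B (j B v), fun φ x => ?_, fun B x => ?_⟩
  · beta_reduce
    rw [hj, hσ]
  · rw [hπ, hrj]

theorem IsSetRetractOfGaPow.of_iso {F G : AbKFunctor k} (e : F ≅ G)
    (h : F.IsSetRetractOfGaPow) : G.IsSetRetractOfGaPow := by
  obtain ⟨ι, hι, j, r, hj, hr, hrj⟩ := h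
  refine ⟨ι, hι, fun B v => j B (e.inv.app B v), fun B x => e.hom.app B (r B x),
    fun φ v => ?_, fun φ x => ?_, fun B v => ?_⟩
  · beta_reduce
    rw [NatTrans.naturality_apply, hj]
  · beta_reduce
    rw [hr, NatTrans.naturality_apply]
  · beta_reduce
    rw [hrj]
    simp

theorem isSetRetractOfGaPow_gaPow (ι : Type) [Countable ι] :
    (gaPow k ι).IsSetRetractOfGaPow :=
  ⟨ι, ‹_›, fun _ v => v, fun _ v => v, fun _ _ => rfl, fun _ _ => rfl, fun _ _ => rfl⟩

theorem IsStrictlyAdditive.isSetRetractOfGaPow {V : AbKFunctor k} (hV : V.IsStrictlyAdditive) :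
    V.IsSetRetractOfGaPow :=
  let ⟨ι, _, ⟨e⟩⟩ := hV
  (isSetRetractOfGaPow_gaPow ι).of_iso e.symm

/-- The lifting property of the quotient gives a set-theoretic section `s` of `S.g`, and then `v ↦
(v - s (g v), g v)` identifies the middle term with the product of the outer ones as a set-valued
functor. -/
theorem isSetRetractOfGaPow_of_shortExact {S : ShortComplex (AbKFunctor k)} (h : S.ShortExact)
    (h₁ : S.X₁.IsSetRetractOfGaPow) (h₃ : S.X₃.IsSetRetractOfGaPow) :
    S.X₂.IsSetRetractOfGaPow := by
  have := h.epi_g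
  obtain ⟨s, hs, hsg⟩ := h₃.exists_lift S.g (fun _ x => x) (fun _ _ => rfl)
  obtain ⟨ι₁, hι₁, j₁, r₁, hj₁, hr₁, hrj₁⟩ := h₁
  obtain ⟨ι₃, hι₃, j₃, r₃, hj₃, hr₃, hrj₃⟩ := h₃
  obtain ⟨d, hd, hfd⟩ := exists_preimage_natural h (X := fun B => S.X₂.obj B)
    (fun φ => S.X₂.map φ) (fun B v => v - s B (S.g.app B v))
    (fun φ x => by rw [NatTrans.naturality_apply, hs, map_sub])
    (fun B x => by rw [map_sub, hsg, sub_self])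
  refine ⟨ι₁ ⊕ ι₃, inferInstance,
    fun B v => Finsupp.sumElim (j₁ B (d B v)) (j₃ B (S.g.app B v)),
    fun B x => S.f.app B (r₁ B (x.comapDomain Sum.inl Sum.inl_injective.injOn)) +
      s B (r₃ B (x.comapDomain Sum.inr Sum.inr_injective.injOn)),
    fun φ v => ?_, fun {B C} φ x => ?_, fun B v => ?_⟩
  · beta_reduce
    rw [hd, hj₁, NatTrans.naturality_apply, hj₃]
    ext i
    cases i <;> simp
  · beta_reduce
    rw [map_add, ← NatTrans.naturality_apply, ← hr₁, ← hs, ← hr₃]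
    congr 3 <;> ext i <;> rfl
  · have e₁ : (Finsupp.sumElim (j₁ B (d B v)) (j₃ B (S.g.app B v))).comapDomain Sum.inl
        Sum.inl_injective.injOn = j₁ B (d B v) := by
      ext i
      simp
    have e₃ : (Finsupp.sumElim (j₁ B (d B v)) (j₃ B (S.g.app B v))).comapDomain Sum.inr
        Sum.inr_injective.injOn = j₃ B (S.g.app B v) := by
      ext i
      simp
    beta_reduce
    rw [e₁, e₃, hrj₁, hrj₃, hfd]
    exact sub_add_cancel _ _

theorem isStrictlyAdditive_of_isZero {Z : AbKFunctor k} (hZ : IsZero Z) :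
    Z.IsStrictlyAdditive := by
  refine ⟨Empty, inferInstance, ⟨hZ.iso ?_⟩⟩
  refine Functor.isZero _ fun B => ?_
  have : Subsingleton ((gaPow k Empty).obj B) :=
    inferInstanceAs (Subsingleton (Empty →₀ B))
  exact AddCommGrpCat.isZero_of_subsingleton _

theorem IsAdditive.isSetRetractOfGaPow {V : AbKFunctor k} (hV : V.IsAdditive) :
    V.IsSetRetractOfGaPow :=
  hV.induction (fun _ hZ => (isStrictlyAdditive_of_isZero hZ).isSetRetractOfGaPow)
    (fun e h => h.of_iso e)
    (fun _ h h₁ h₃ => isSetRetractOfGaPow_of_shortExact h h₁ h₃.isSetRetractOfGaPow)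

theorem IsAdditive.surjective_comp_mapToSet {V W G : AbKFunctor k} (π : W ⟶ G) [Epi π]
    (hV : V.IsAdditive) :
    Function.Surjective (fun σ : V.toSet ⟶ W.toSet => σ ≫ mapToSet π) := by
  intro τ
  obtain ⟨σ, hσ, h⟩ := hV.isSetRetractOfGaPow.exists_lift π (fun B x => τ.app B x)
    (setHom_naturality τ)
  exact ⟨setHomMk σ hσ, setHom_ext h⟩

theorem IsAdditive.extOneSetSplit_eq_univ {V : AbKFunctor k} (hV : V.IsAdditive)
    (F : AbKFunctor k) : extOneSetSplit V F = Set.univ := by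
  refine Set.eq_univ_of_forall fun x => ?_
  obtain ⟨E, rfl⟩ := Quotient.exists_rep x
  have : Epi E.p := E.shortExact.epi_g
  exact ⟨E, hV.surjective_comp_mapToSet E.p (𝟙 _), rfl⟩

/-! ### Subnilpotent by discrete extensions -/

/-- The reduction of a `k`-algebra. -/
abbrev reduction (B : CommAlgCat.{u} k) : CommAlgCat.{u} k := .of k (B ⧸ nilradical B)

abbrev toReduction (B : CommAlgCat.{u} k) : B ⟶ reduction B :=
  CommAlgCat.ofHom (Ideal.Quotient.mkₐ k (nilradical B))

theorem isReduced_reduction (B : CommAlgCat.{u} k) : IsReduced (reduction B) :=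
  (Ideal.isRadical_iff_quotient_reduced _).1 (Ideal.radical_isRadical _)

theorem exists_reduction_map {B C : CommAlgCat.{u} k} (φ : B ⟶ C) :
    ∃ ψ : reduction B ⟶ reduction C, φ ≫ toReduction C = toReduction B ≫ ψ := by
  refine ⟨CommAlgCat.ofHom (Ideal.quotientMapₐ (nilradical C) φ.hom fun x hx => ?_), ?_⟩
  · rw [mem_nilradical] at hx
    exact mem_nilradical.2 (hx.map φ.hom)
  · ext x
    rfl

theorem bijective_constSheaf_map_toReduction (A : Type u) [AddCommGroup A]
    (B : CommAlgCat.{u} k) : Function.Bijective ((constSheaf k A).map (toReduction B)) := by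
  have h : IsHomeomorph (PrimeSpectrum.comap (Ideal.Quotient.mk (nilradical B))) := by
    refine PrimeSpectrum.isHomeomorph_comap _ (fun x => ⟨1, one_pos, ?_⟩) ?_
    · rw [pow_one]
      exact Ideal.Quotient.mk_surjective x
    · rw [Ideal.mk_ker]
  exact (LocallyConstant.congrLeft (Z := A) h.homeomorph.symm).bijective

theorem IsDiscrete.bijective_map_toReduction {D : AbKFunctor k} (hD : D.IsDiscrete)
    (B : CommAlgCat.{u} k) : Function.Bijective (D.map (toReduction B)) := by
  obtain ⟨A, ⟨e⟩⟩ := hD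
  have hbij (B : CommAlgCat.{u} k) : Function.Bijective (e.hom.app B) :=
    ConcreteCategory.bijective_of_isIso _
  rw [← (hbij _).of_comp_iff' , ← ConcreteCategory.coe_comp, e.hom.naturality,
    ConcreteCategory.coe_comp]
  exact (bijective_constSheaf_map_toReduction A B).comp (hbij B)

theorem IsSubnilpotent.subsingleton_obj {I : AbKFunctor k} (hI : I.IsSubnilpotent)
    (B : CommAlgCat.{u} k) (hB : IsReduced B) : Subsingleton (I.obj B) := by
  obtain ⟨N, j, hj, -, hN⟩ := hI
  have := hN B hB
  exact ((AddCommGrpCat.mono_iff_injective _).1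
    ((NatTrans.mono_iff_mono_app j).1 hj B)).subsingleton

/-- Over the reduced quotient the extension coincides with `D`, whose value there is already its
value at `B`. The retraction `r` is passage to the quotient; its properties are checked after the
injective map `hinj`. -/
theorem IsSubnilpotent.extOneVanishes {I D : AbKFunctor k} (hI : I.IsSubnilpotent)
    (hD : D.IsDiscrete) : ExtOneVanishes I D := by
  refine extOneVanishes_of_retraction fun E => ?_
  have hinj (B : CommAlgCat.{u} k) {d d' : D.obj B}
      (h : E.i.app _ (D.map (toReduction B) d) = E.i.app _ (D.map (toReduction B) d')) :
      d = d' :=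
    (hD.bijective_map_toReduction B).1 (app_injective E.shortExact _ h)
  have hex (B : CommAlgCat.{u} k) (x : E.obj.obj B) :
      ∃ d : D.obj B, E.i.app _ (D.map (toReduction B) d) = E.obj.map (toReduction B) x := by
    have := hI.subsingleton_obj _ (isReduced_reduction B)
    obtain ⟨y, hy⟩ := app_exact E.shortExact (x := E.obj.map (toReduction B) x)
      (Subsingleton.elim _ _)
    obtain ⟨d, rfl⟩ := (hD.bijective_map_toReduction B).2 y
    exact ⟨d, hy⟩
  choose r hr using hex
  refine ⟨homMk r (fun B x y => hinj B ?_) (fun {B C} φ x => hinj C ?_), ?_⟩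
  · rw [hr, map_add, map_add, map_add, hr, hr]
  · obtain ⟨ψ, hψ⟩ := exists_reduction_map φ
    have h₁ (F : AbKFunctor k) (y : F.obj B) :
        F.map (toReduction C) (F.map φ y) = F.map ψ (F.map (toReduction B) y) := by
      rw [← ConcreteCategory.comp_apply, ← F.map_comp, hψ, F.map_comp,
        ConcreteCategory.comp_apply]
    rw [hr, h₁, h₁, NatTrans.naturality_apply, hr]
  · ext B x
    refine hinj B ?_
    refine (hr B (E.i.app B x)).trans ?_
    rw [← NatTrans.naturality_apply]
    rfl

/-! ### Natural cocycles on `𝔾ₘ` -/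

/-- The map on units induced by a homomorphism of `k`-algebras. -/
def unitsMap {B C : CommAlgCat.{u} k} (φ : B ⟶ C) : Bˣ →* Cˣ := Units.map (φ.hom : B →* C)

theorem unitsMap_comp {A B C : CommAlgCat.{u} k} (φ : A ⟶ B) (ψ : B ⟶ C) (a : Aˣ) :
    unitsMap (φ ≫ ψ) a = unitsMap ψ (unitsMap φ a) := rfl

theorem coe_unitsMap {B C : CommAlgCat.{u} k} (φ : B ⟶ C) (a : Bˣ) :
    (unitsMap φ a : C) = φ.hom a := rfl

section Lift

variable {W G : AbKFunctor k} (π : W ⟶ G) [Epi π]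

/-- Natural maps out of powers of `𝔾ₘ` lift along epimorphisms, by representability. -/
theorem exists_lift_units {J : Type} (τ : ∀ B : CommAlgCat.{u} k, (J → Bˣ) → G.obj B)
    (hτ : ∀ {B C : CommAlgCat.{u} k} (φ : B ⟶ C) (x : J → Bˣ),
      τ C (fun j => unitsMap φ (x j)) = G.map φ (τ B x)) :
    ∃ σ : ∀ B : CommAlgCat.{u} k, (J → Bˣ) → W.obj B,
      (∀ {B C : CommAlgCat.{u} k} (φ : B ⟶ C) (x : J → Bˣ),
        σ C (fun j => unitsMap φ (x j)) = W.map φ (σ B x)) ∧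
      ∀ B x, π.app B (σ B x) = τ B x := by
  -- The group algebra of the free abelian group on `J` represents `B ↦ (J → Bˣ)`, with universal
  -- point `ξ`.
  let A : CommAlgCat.{u} k := .of k (MonoidAlgebra k (Multiplicative (FreeAbelianGroup J)))
  let ξ : J → Aˣ := fun j => Units.map
    (MonoidAlgebra.of k (Multiplicative (FreeAbelianGroup J)))
    (toUnits (Multiplicative.ofAdd (FreeAbelianGroup.of j)))
  obtain ⟨w, hw⟩ := app_surjective_of_epi π A (τ A ξ)
  let χ {B : CommAlgCat.{u} k} (x : J → Bˣ) : Multiplicative (FreeAbelianGroup J) →* B :=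
    (Units.coeHom B).comp (AddMonoidHom.toMultiplicativeLeft
      (FreeAbelianGroup.lift (fun j => Additive.ofMul (x j))))
  let ev {B : CommAlgCat.{u} k} (x : J → Bˣ) : A ⟶ B :=
    CommAlgCat.ofHom (MonoidAlgebra.lift k B (Multiplicative (FreeAbelianGroup J)) (χ x))
  have hev {B : CommAlgCat.{u} k} (x : J → Bˣ) (j : J) : unitsMap (ev x) (ξ j) = x j := by
    ext
    rw [coe_unitsMap]
    refine (MonoidAlgebra.lift_of _ _).trans ?_
    simp [χ]
  refine ⟨fun B x => W.map (ev x) w, fun {B C} φ x => ?_, fun B x => ?_⟩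
  · have : ev (fun j => unitsMap φ (x j)) = ev x ≫ φ := by
      ext : 1
      have hlift : FreeAbelianGroup.lift (fun j => Additive.ofMul (unitsMap φ (x j))) =
          (MonoidHom.toAdditive (unitsMap φ)).comp
            (FreeAbelianGroup.lift (fun j => Additive.ofMul (x j))) := by
        ext j
        simp
      refine MonoidAlgebra.algHom_ext (R := k) (A := k)
        (M := Multiplicative (FreeAbelianGroup J)) (fun m => ?_) (Subsingleton.elim _ _)
      refine (MonoidAlgebra.lift_of _ m).trans ?_
      simp only [χ, hlift]
      exact congrArg φ.hom (MonoidAlgebra.lift_of (R := k) (χ x) m).symm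
    beta_reduce
    rw [this, Functor.map_comp]
    rfl
  · rw [NatTrans.naturality_apply, hw, ← hτ]
    simp only [hev]

theorem exists_lift_units₁ (τ : ∀ B : CommAlgCat.{u} k, Bˣ → G.obj B)
    (hτ : ∀ {B C : CommAlgCat.{u} k} (φ : B ⟶ C) a,
      τ C (unitsMap φ a) = G.map φ (τ B a)) :
    ∃ σ : ∀ B : CommAlgCat.{u} k, Bˣ → W.obj B,
      (∀ {B C : CommAlgCat.{u} k} (φ : B ⟶ C) a,
        σ C (unitsMap φ a) = W.map φ (σ B a)) ∧
      ∀ B a, π.app B (σ B a) = τ B a := by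
  obtain ⟨σ, hσ, h⟩ := exists_lift_units (J := Unit) π (fun B x => τ B (x ()))
    (fun φ x => hτ φ _)
  exact ⟨fun B a => σ B fun _ => a, fun φ a => hσ φ _, fun B a => h B _⟩

theorem exists_lift_units₂ (τ : ∀ B : CommAlgCat.{u} k, Bˣ → Bˣ → G.obj B)
    (hτ : ∀ {B C : CommAlgCat.{u} k} (φ : B ⟶ C) a b,
      τ C (unitsMap φ a) (unitsMap φ b) = G.map φ (τ B a b)) :
    ∃ σ : ∀ B : CommAlgCat.{u} k, Bˣ → Bˣ → W.obj B,
      (∀ {B C : CommAlgCat.{u} k} (φ : B ⟶ C) a b,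
        σ C (unitsMap φ a) (unitsMap φ b) = W.map φ (σ B a b)) ∧
      ∀ B a b, π.app B (σ B a b) = τ B a b := by
  obtain ⟨σ, hσ, h⟩ := exists_lift_units (J := Fin 2) π (fun B x => τ B (x 0) (x 1))
    (fun φ x => hτ φ _ _)
  refine ⟨fun B a b => σ B ![a, b], fun φ a b => ?_, fun B a b => h B _⟩
  beta_reduce
  rw [← hσ]
  congr 1
  funext j
  fin_cases j <;> rfl

end Lift

/-- Every natural 2-cocycle of `𝔾ₘ` with values in `F` is a coboundary. -/
def TwoCocyclesBound (F : AbKFunctor k) : Prop :=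
  ∀ f : ∀ B : CommAlgCat.{u} k, Bˣ → Bˣ → F.obj B,
    (∀ {B C : CommAlgCat.{u} k} (φ : B ⟶ C) a b,
      f C (unitsMap φ a) (unitsMap φ b) = F.map φ (f B a b)) →
    (∀ B a b c, f B b c - f B (a * b) c + f B a (b * c) - f B a b = 0) →
    ∃ g : ∀ B : CommAlgCat.{u} k, Bˣ → F.obj B,
      (∀ {B C : CommAlgCat.{u} k} (φ : B ⟶ C) a, g C (unitsMap φ a) = F.map φ (g B a)) ∧
      ∀ B a b, f B a b = g B b - g B (a * b) + g B a

/-- Every natural 3-cocycle of `𝔾ₘ` with values in `F` is a coboundary. -/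
def ThreeCocyclesBound (F : AbKFunctor k) : Prop :=
  ∀ f : ∀ B : CommAlgCat.{u} k, Bˣ → Bˣ → Bˣ → F.obj B,
    (∀ {B C : CommAlgCat.{u} k} (φ : B ⟶ C) a b c,
      f C (unitsMap φ a) (unitsMap φ b) (unitsMap φ c) = F.map φ (f B a b c)) →
    (∀ B a b c d, f B b c d - f B (a * b) c d + f B a (b * c) d - f B a b (c * d)
      + f B a b c = 0) →
    ∃ g : ∀ B : CommAlgCat.{u} k, Bˣ → Bˣ → F.obj B,
      (∀ {B C : CommAlgCat.{u} k} (φ : B ⟶ C) a b,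
        g C (unitsMap φ a) (unitsMap φ b) = F.map φ (g B a b)) ∧
      ∀ B a b c, f B a b c = g B b c - g B (a * b) c + g B a (b * c) - g B a b

section Devissage

variable {S : ShortComplex (AbKFunctor k)} (h : S.ShortExact)

include h

/-- Exactness of `H²(X₁) → H²(X₂) → H²(X₃)`. Cochains lift along `S.g` because powers of `𝔾ₘ` are
representable; after subtracting the coboundary of a lift, the cocycle takes values in `X₁`. -/
theorem TwoCocyclesBound.of_shortExact (h₁ : S.X₁.TwoCocyclesBound)
    (h₃ : S.X₃.TwoCocyclesBound) : S.X₂.TwoCocyclesBound := by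
  intro f hf hc
  have := h.epi_g
  obtain ⟨g₃, hg₃, hfg₃⟩ := h₃ (fun B a b => S.g.app B (f B a b))
    (fun φ a b => by rw [hf, NatTrans.naturality_apply])
    (fun B a b c => by rw [← map_sub, ← map_add, ← map_sub, hc, map_zero])
  obtain ⟨g₂, hg₂, hgg⟩ := exists_lift_units₁ S.g g₃ hg₃
  obtain ⟨f₁, hf₁, hff⟩ := exists_preimage_natural h (X := fun B => Bˣ × Bˣ)
    (fun φ x => (unitsMap φ x.1, unitsMap φ x.2))
    (fun B x => f B x.1 x.2 - (g₂ B x.2 - g₂ B (x.1 * x.2) + g₂ B x.1))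
    (fun φ x => by simp only [hf, ← map_mul, hg₂, map_sub, map_add])
    (fun B x => by simp only [map_sub, map_add, hfg₃, hgg, sub_self])
  obtain ⟨g₁, hg₁, hfg₁⟩ := h₁ (fun B a b => f₁ B (a, b)) (fun φ a b => hf₁ φ (a, b))
    (fun B a b c => by
      apply app_injective h
      simp only [map_sub, map_add, hff, map_zero, ← mul_assoc]
      have := hc B a b c
      rw [← this]
      abel)
  refine ⟨fun B a => S.f.app B (g₁ B a) + g₂ B a, fun φ a => ?_, fun B a b => ?_⟩
  · beta_reduce
    rw [hg₁, hg₂, NatTrans.naturality_apply, map_add]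
  · beta_reduce
    have e₁ := hff B (a, b)
    have e₂ := congrArg (S.f.app B) (hfg₁ B a b)
    simp only [map_sub, map_add] at e₂
    rw [e₂] at e₁
    rw [← sub_eq_zero] at e₁ ⊢
    rw [← neg_eq_zero, ← e₁]
    abel

theorem ThreeCocyclesBound.of_shortExact (h₁ : S.X₁.ThreeCocyclesBound)
    (h₃ : S.X₃.ThreeCocyclesBound) : S.X₂.ThreeCocyclesBound := by
  intro f hf hc
  have := h.epi_g
  obtain ⟨g₃, hg₃, hfg₃⟩ := h₃ (fun B a b c => S.g.app B (f B a b c))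
    (fun φ a b c => by rw [hf, NatTrans.naturality_apply])
    (fun B a b c d => by
      rw [← map_sub, ← map_add, ← map_sub, ← map_add, hc, map_zero])
  obtain ⟨g₂, hg₂, hgg⟩ := exists_lift_units₂ S.g g₃ hg₃
  obtain ⟨f₁, hf₁, hff⟩ := exists_preimage_natural h (X := fun B => Bˣ × Bˣ × Bˣ)
    (fun φ x => (unitsMap φ x.1, unitsMap φ x.2.1, unitsMap φ x.2.2))
    (fun B x => f B x.1 x.2.1 x.2.2 - (g₂ B x.2.1 x.2.2 - g₂ B (x.1 * x.2.1) x.2.2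
      + g₂ B x.1 (x.2.1 * x.2.2) - g₂ B x.1 x.2.1))
    (fun φ x => by simp only [hf, ← map_mul, hg₂, map_sub, map_add])
    (fun B x => by simp only [map_sub, map_add, hfg₃, hgg, sub_self])
  obtain ⟨g₁, hg₁, hfg₁⟩ := h₁ (fun B a b c => f₁ B (a, b, c))
    (fun φ a b c => hf₁ φ (a, b, c))
    (fun B a b c d => by
      apply app_injective h
      simp only [map_sub, map_add, hff, map_zero, ← mul_assoc]
      have := hc B a b c d
      rw [← this]
      abel)
  refine ⟨fun B a b => S.f.app B (g₁ B a b) + g₂ B a b, fun φ a b => ?_, fun B a b c => ?_⟩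
  · beta_reduce
    rw [hg₁, hg₂, NatTrans.naturality_apply, map_add]
  · beta_reduce
    have e₁ := hff B (a, b, c)
    have e₂ := congrArg (S.f.app B) (hfg₁ B a b c)
    simp only [map_sub, map_add] at e₂
    rw [e₂] at e₁
    rw [← sub_eq_zero] at e₁ ⊢
    rw [← neg_eq_zero, ← e₁]
    abel

/-- Exactness of `H²(X₂) → H²(X₃) → H³(X₁)`: the coboundary of a lifted cochain is a 3-cocycle in
`X₁`, and a primitive of it corrects the lift to a cocycle. -/
theorem TwoCocyclesBound.of_shortExact_of_three (h₁ : S.X₁.ThreeCocyclesBound)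
    (h₂ : S.X₂.TwoCocyclesBound) : S.X₃.TwoCocyclesBound := by
  intro f hf hc
  have := h.epi_g
  obtain ⟨f₂, hf₂, hff⟩ := exists_lift_units₂ S.g f hf
  obtain ⟨f₁, hf₁, hff₁⟩ := exists_preimage_natural h (X := fun B => Bˣ × Bˣ × Bˣ)
    (fun φ x => (unitsMap φ x.1, unitsMap φ x.2.1, unitsMap φ x.2.2))
    (fun B x => f₂ B x.2.1 x.2.2 - f₂ B (x.1 * x.2.1) x.2.2
      + f₂ B x.1 (x.2.1 * x.2.2) - f₂ B x.1 x.2.1)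
    (fun φ x => by simp only [← map_mul, hf₂, map_sub, map_add])
    (fun B x => by simp only [map_sub, map_add, hff, hc])
  obtain ⟨g₁, hg₁, hfg₁⟩ := h₁ (fun B a b c => f₁ B (a, b, c))
    (fun φ a b c => hf₁ φ (a, b, c))
    (fun B a b c d => by
      apply app_injective h
      simp only [map_sub, map_add, hff₁, map_zero, ← mul_assoc]
      abel)
  obtain ⟨g₂, hg₂, hfg₂⟩ := h₂ (fun B a b => f₂ B a b - S.f.app B (g₁ B a b))
    (fun φ a b => by rw [hf₂, hg₁, NatTrans.naturality_apply, map_sub])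
    (fun B a b c => by
      have e₁ := hff₁ B (a, b, c)
      have e₂ := congrArg (S.f.app B) (hfg₁ B a b c)
      simp only [map_sub, map_add] at e₂
      rw [e₂] at e₁
      rw [← sub_eq_zero] at e₁
      rw [← neg_eq_zero, ← e₁]
      abel)
  refine ⟨fun B a => S.g.app B (g₂ B a), fun φ a => ?_, fun B a b => ?_⟩
  · beta_reduce
    rw [hg₂, NatTrans.naturality_apply]
  · have e₁ := congrArg (S.g.app B) (hfg₂ B a b)
    simpa only [map_sub, map_add, hff, app_comp_eq_zero, sub_zero] using e₁

end Devissage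

theorem TwoCocyclesBound.of_iso {F G : AbKFunctor k} (e : F ≅ G) (h : F.TwoCocyclesBound) :
    G.TwoCocyclesBound := by
  intro f hf hc
  obtain ⟨g, hg, hfg⟩ := h (fun B a b => e.inv.app B (f B a b))
    (fun φ a b => by rw [hf, NatTrans.naturality_apply])
    (fun B a b c => by rw [← map_sub, ← map_add, ← map_sub, hc, map_zero])
  refine ⟨fun B a => e.hom.app B (g B a), fun φ a => ?_, fun B a b => ?_⟩
  · beta_reduce
    rw [hg, NatTrans.naturality_apply]
  · have := congrArg (e.hom.app B) (hfg B a b)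
    simpa using this

theorem ThreeCocyclesBound.of_iso {F G : AbKFunctor k} (e : F ≅ G)
    (h : F.ThreeCocyclesBound) : G.ThreeCocyclesBound := by
  intro f hf hc
  obtain ⟨g, hg, hfg⟩ := h (fun B a b c => e.inv.app B (f B a b c))
    (fun φ a b c => by rw [hf, NatTrans.naturality_apply])
    (fun B a b c d => by
      rw [← map_sub, ← map_add, ← map_sub, ← map_add, hc, map_zero])
  refine ⟨fun B a b => e.hom.app B (g B a b), fun φ a b => ?_, fun B a b c => ?_⟩
  · beta_reduce
    rw [hg, NatTrans.naturality_apply]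
  · have := congrArg (e.hom.app B) (hfg B a b c)
    simpa using this

/-! ### The constant term as an invariant mean on `𝔾ₘ` -/

section Laurent

open LaurentPolynomial

/-- Laurent polynomials over a `k`-algebra. -/
noncomputable abbrev laurent (B : CommAlgCat.{u} k) : CommAlgCat.{u} k := .of k B[T;T⁻¹]

/-- The inclusion of the constants. -/
noncomputable def laurentC (B : CommAlgCat.{u} k) : B ⟶ laurent B :=
  CommAlgCat.ofHom (IsScalarTower.toAlgHom k B B[T;T⁻¹])

/-- The coordinate of the ring of Laurent polynomials. -/
noncomputable def laurentT (B : CommAlgCat.{u} k) : (laurent B)ˣ where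
  val := (T 1 : B[T;T⁻¹])
  inv := (T (-1) : B[T;T⁻¹])
  val_inv := by rw [← T_add]; simp
  inv_val := by rw [← T_add]; simp

/-- Extension of a homomorphism to Laurent polynomials. -/
noncomputable def laurentLift {B D : CommAlgCat.{u} k} (φ : B ⟶ D) (d : Dˣ) : laurent B ⟶ D :=
  CommAlgCat.ofHom
    { eval₂ (φ.hom : B →+* D) d with
      commutes' := fun r => by
        change eval₂ (φ.hom : B →+* D) d (algebraMap k B[T;T⁻¹] r) = _
        rw [IsScalarTower.algebraMap_apply k B B[T;T⁻¹], ← C_eq_algebraMap, eval₂_C]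
        exact φ.hom.commutes r }

theorem laurentC_comp_laurentLift {B D : CommAlgCat.{u} k} (φ : B ⟶ D) (d : Dˣ) :
    laurentC B ≫ laurentLift φ d = φ := by
  ext b
  exact eval₂_C (φ.hom : B →+* D) d b

theorem unitsMap_laurentLift_T {B D : CommAlgCat.{u} k} (φ : B ⟶ D) (d : Dˣ) :
    unitsMap (laurentLift φ d) (laurentT B) = d := by
  ext
  refine (eval₂_T (φ.hom : B →+* D) d 1).trans ?_
  simp

theorem unitsMap_laurentLift_C {B D : CommAlgCat.{u} k} (φ : B ⟶ D) (d : Dˣ) (b : Bˣ) :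
    unitsMap (laurentLift φ d) (unitsMap (laurentC B) b) = unitsMap φ b := by
  rw [← unitsMap_comp, laurentC_comp_laurentLift]

theorem val_laurentT_zpow (B : CommAlgCat.{u} k) (n : ℤ) :
    ((laurentT B ^ n : (laurent B)ˣ) : B[T;T⁻¹]) = T n := by
  have h : laurentT B = Units.map (AddMonoidAlgebra.of B ℤ) (toUnits (Multiplicative.ofAdd 1)) :=
    Units.ext rfl
  rw [h, ← map_zpow, ← map_zpow, ← ofAdd_zsmul, smul_eq_mul, mul_one]
  rfl

theorem coeff_zero_C_mul_T {R : Type*} [CommRing R] (r : R) (n : ℤ) :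
    (C r * T n : R[T;T⁻¹]).coeff 0 = if n = 0 then r else 0 := by
  rw [← single_eq_C_mul_T, AddMonoidAlgebra.coeff_single, Finsupp.single_apply]

theorem coeff_zero_laurentLift_map {B D : CommAlgCat.{u} k} (φ : B ⟶ D) (p : B[T;T⁻¹]) :
    (eval₂ ((φ ≫ laurentC D).hom : B →+* D[T;T⁻¹]) (laurentT D) p).coeff 0 =
      φ.hom (p.coeff 0) := by
  induction p using LaurentPolynomial.induction_on' with
  | add p q hp hq =>
    rw [map_add, AddMonoidAlgebra.coeff_add, Finsupp.add_apply, hp, hq, AddMonoidAlgebra.coeff_add,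
      Finsupp.add_apply, map_add]
  | C_mul_T n b =>
    rw [eval₂_C_mul_T, val_laurentT_zpow, coeff_zero_C_mul_T, apply_ite φ.hom, map_zero φ.hom]
    exact coeff_zero_C_mul_T _ n

/-- Translation invariance of the mean: `T ↦ bT` multiplies the coefficient of `T^n` by `b^n`, which
is `1` for `n = 0`. -/
theorem coeff_zero_laurentLift_mul {B : CommAlgCat.{u} k} (b : Bˣ) (p : B[T;T⁻¹]) :
    (eval₂ ((laurentC B).hom : B →+* B[T;T⁻¹]) (unitsMap (laurentC B) b * laurentT B) p).coeff 0 =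
      p.coeff 0 := by
  induction p using LaurentPolynomial.induction_on' with
  | add p q hp hq =>
    rw [map_add, AddMonoidAlgebra.coeff_add, Finsupp.add_apply, hp, hq, AddMonoidAlgebra.coeff_add,
      Finsupp.add_apply]
  | C_mul_T n c =>
    rw [eval₂_C_mul_T, mul_zpow, Units.val_mul, val_laurentT_zpow, coeff_zero_C_mul_T, ← map_zpow,
      ← mul_assoc]
    refine (congrArg (fun p => (p * T n).coeff 0) (C.map_mul c ((b ^ n : Bˣ) : B)).symm).trans ?_
    rw [coeff_zero_C_mul_T]
    split_ifs with h <;> simp [h]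

/-- The constant term, applied to each coordinate. -/
noncomputable def constantTerm {ι : Type} (B : CommAlgCat.{u} k) :
    (gaPow k ι).obj (laurent B) →+ (gaPow k ι).obj B :=
  Finsupp.mapRange.addMonoidHom
    { toFun := fun p : B[T;T⁻¹] => p.coeff 0, map_zero' := rfl, map_add' := fun _ _ => rfl }

theorem constantTerm_map {ι : Type} {B D : CommAlgCat.{u} k} (φ : B ⟶ D)
    (x : (gaPow k ι).obj (laurent B)) :
    constantTerm D ((gaPow k ι).map (laurentLift (φ ≫ laurentC D) (laurentT D)) x) =
      (gaPow k ι).map φ (constantTerm B x) :=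
  Finsupp.ext fun _ => coeff_zero_laurentLift_map φ _

theorem constantTerm_map_mul {ι : Type} {B : CommAlgCat.{u} k} (b : Bˣ)
    (x : (gaPow k ι).obj (laurent B)) :
    constantTerm B ((gaPow k ι).map
      (laurentLift (laurentC B) (unitsMap (laurentC B) b * laurentT B)) x) = constantTerm B x :=
  Finsupp.ext fun _ => coeff_zero_laurentLift_mul b _

theorem constantTerm_map_C {ι : Type} {B : CommAlgCat.{u} k} (x : (gaPow k ι).obj B) :
    constantTerm B ((gaPow k ι).map (laurentC B) x) = x :=
  Finsupp.ext fun _ => (C_apply _ 0).trans (if_pos rfl)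

end Laurent

/-- Average over the last variable: `g a` is the mean of `f(a, T)`. The mean of the cocycle identity
at `(a, b, T)`, with invariance turning `f(a, bT)` into `f(a, T)`, is the claim. -/
theorem twoCocyclesBound_gaPow (ι : Type) : (gaPow k ι).TwoCocyclesBound := by
  intro f hf hc
  have hinv (B : CommAlgCat.{u} k) (a b : Bˣ) :
      constantTerm B (f (laurent B) (unitsMap (laurentC B) a)
        (unitsMap (laurentC B) b * laurentT B)) =
      constantTerm B (f (laurent B) (unitsMap (laurentC B) a) (laurentT B)) := by
    rw [← constantTerm_map_mul b (f _ _ (laurentT B)), ← hf, unitsMap_laurentLift_C,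
      unitsMap_laurentLift_T]
  refine ⟨fun B a => constantTerm B (f (laurent B) (unitsMap (laurentC B) a) (laurentT B)),
    fun {B D} φ a => ?_, fun B a b => ?_⟩
  · beta_reduce
    rw [← constantTerm_map, ← hf, unitsMap_laurentLift_C, unitsMap_laurentLift_T, unitsMap_comp]
  · have := congrArg (constantTerm B) (hc (laurent B) (unitsMap (laurentC B) a)
      (unitsMap (laurentC B) b) (laurentT B))
    rw [hf, map_sub, map_add, map_sub, map_zero, hinv, constantTerm_map_C, ← map_mul,
      sub_eq_zero] at this
    exact this.symm

/-- The same averaging at `(a, b, c, T)`; the sign of `f(a, b, c)` in the cocycle identity is now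
positive, hence the minus sign in the primitive. -/
theorem threeCocyclesBound_gaPow (ι : Type) : (gaPow k ι).ThreeCocyclesBound := by
  intro f hf hc
  have hinv (B : CommAlgCat.{u} k) (a b c : Bˣ) :
      constantTerm B (f (laurent B) (unitsMap (laurentC B) a) (unitsMap (laurentC B) b)
        (unitsMap (laurentC B) c * laurentT B)) =
      constantTerm B (f (laurent B) (unitsMap (laurentC B) a) (unitsMap (laurentC B) b)
        (laurentT B)) := by
    rw [← constantTerm_map_mul c (f _ _ _ (laurentT B)), ← hf, unitsMap_laurentLift_C,
      unitsMap_laurentLift_C,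
      unitsMap_laurentLift_T]
  refine ⟨fun B a b => - constantTerm B (f (laurent B) (unitsMap (laurentC B) a)
    (unitsMap (laurentC B) b) (laurentT B)), fun {B D} φ a b => ?_, fun B a b c => ?_⟩
  · beta_reduce
    rw [map_neg, ← constantTerm_map, ← hf, unitsMap_laurentLift_C, unitsMap_laurentLift_C,
      unitsMap_laurentLift_T, unitsMap_comp, unitsMap_comp]
  · have := congrArg (constantTerm B) (hc (laurent B) (unitsMap (laurentC B) a)
      (unitsMap (laurentC B) b) (unitsMap (laurentC B) c) (laurentT B))
    rw [hf, map_add, map_sub, map_add, map_sub, map_zero, hinv, constantTerm_map_C,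
      ← map_mul, ← map_mul] at this
    beta_reduce
    rw [← sub_eq_zero, ← this]
    abel

theorem IsAdditive.twoCocyclesBound {V : AbKFunctor k} (hV : V.IsAdditive) :
    V.TwoCocyclesBound :=
  have h {F : AbKFunctor k} : F.IsStrictlyAdditive → F.TwoCocyclesBound :=
    fun ⟨ι, _, ⟨e⟩⟩ => (twoCocyclesBound_gaPow ι).of_iso e.symm
  hV.induction (fun _ hZ => h (isStrictlyAdditive_of_isZero hZ)) (fun e h => h.of_iso e)
    (fun _ hS h₁ h₃ => .of_shortExact hS h₁ (h h₃))

theorem IsAdditive.threeCocyclesBound {V : AbKFunctor k} (hV : V.IsAdditive) :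
    V.ThreeCocyclesBound :=
  have h {F : AbKFunctor k} : F.IsStrictlyAdditive → F.ThreeCocyclesBound :=
    fun ⟨ι, _, ⟨e⟩⟩ => (threeCocyclesBound_gaPow ι).of_iso e.symm
  hV.induction (fun _ hZ => h (isStrictlyAdditive_of_isZero hZ)) (fun e h => h.of_iso e)
    (fun _ hS h₁ h₃ => .of_shortExact hS h₁ (h h₃))

/-- An element of `𝔾ₘ(B)` as a unit of `B`. -/
def gmUnit {B : CommAlgCat.{u} k} (x : (gm k).obj B) : Bˣ := Additive.toMul (α := Bˣ) x

theorem gmUnit_add {B : CommAlgCat.{u} k} (x y : (gm k).obj B) :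
    gmUnit (x + y) = gmUnit x * gmUnit y := rfl

theorem gmUnit_map {B D : CommAlgCat.{u} k} (φ : B ⟶ D) (x : (gm k).obj B) :
    gmUnit ((gm k).map φ x) = unitsMap φ (gmUnit x) := rfl

/-- A set-theoretic section exists by representability; subtracting a primitive of its defect of
additivity makes it a homomorphism. -/
theorem TwoCocyclesBound.extOneVanishes {P : AbKFunctor k} (hP : P.TwoCocyclesBound) :
    ExtOneVanishes (gm k) P := by
  refine extOneVanishes_of_section fun E => ?_
  have : Epi E.p := E.shortExact.epi_g
  obtain ⟨s, hs, hps⟩ := exists_lift_units₁ E.p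
    (fun B a => (Additive.ofMul a : Additive Bˣ)) (fun φ a => rfl)
  have hpm (B : CommAlgCat.{u} k) (a b : Bˣ) :
      E.p.app B (s B (a * b)) = E.p.app B (s B a) + E.p.app B (s B b) := by
    simp only [hps]
    rfl
  obtain ⟨f, hf, hif⟩ := exists_preimage_natural E.shortExact (X := fun B => Bˣ × Bˣ)
    (fun φ x => (unitsMap φ x.1, unitsMap φ x.2))
    (fun B x => s B x.2 - s B (x.1 * x.2) + s B x.1)
    (fun φ x => by simp only [← map_mul, hs, map_sub, map_add])
    (fun B x => by
      simp only [map_sub, map_add, hpm]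
      abel)
  obtain ⟨g, hg, hfg⟩ := hP (fun B a b => f B (a, b)) (fun φ a b => hf φ (a, b))
    (fun B a b c => by
      apply app_injective E.shortExact
      simp only [map_sub, map_add, hif, map_zero, ← mul_assoc]
      abel)
  refine ⟨homMk (fun B x => s B (gmUnit x) - E.i.app B (g B (gmUnit x))) (fun B x y => ?_)
    (fun {B D} φ x => ?_), ?_⟩
  · have e₁ := hif B (gmUnit x, gmUnit y)
    have e₂ := congrArg (E.i.app B) (hfg B (gmUnit x) (gmUnit y))
    simp only [map_sub, map_add] at e₂
    rw [e₂, ← sub_eq_zero] at e₁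
    rw [gmUnit_add, ← sub_eq_zero, ← e₁]
    abel
  · rw [gmUnit_map, hs, hg, NatTrans.naturality_apply, map_sub]
  · ext B x
    change E.p.app B (s B (gmUnit x) - E.i.app B (g B (gmUnit x))) = x
    rw [map_sub, app_comp_eq_zero ⟨E.i, E.p, E.zero⟩, sub_zero]
    exact hps B _

theorem extOneVanishes_gm_of_shortExact {S : ShortComplex (AbKFunctor k)} (hS : S.ShortExact)
    (h₁ : S.X₁.IsAdditive) (h₂ : S.X₂.IsAdditive) : ExtOneVanishes (gm k) S.X₃ :=
  (TwoCocyclesBound.of_shortExact_of_three hS h₁.threeCocyclesBound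
    h₂.twoCocyclesBound).extOneVanishes

/-! ### Weights under doubling in characteristic zero -/

section Polynomials

open Polynomial

/-- Polynomials over a `k`-algebra. -/
noncomputable abbrev poly (B : CommAlgCat.{u} k) : CommAlgCat.{u} k := .of k B[X]

/-- The inclusion of the constants. -/
noncomputable def polyC (B : CommAlgCat.{u} k) : B ⟶ poly B :=
  CommAlgCat.ofHom (IsScalarTower.toAlgHom k B B[X])

/-- Evaluation of polynomials. -/
noncomputable def polyEval {B D : CommAlgCat.{u} k} (φ : B ⟶ D) (d : D) : poly B ⟶ D :=
  CommAlgCat.ofHom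
    { eval₂RingHom (φ.hom : B →+* D) d with
      commutes' := fun r => by
        change eval₂ (φ.hom : B →+* D) d (algebraMap k B[X] r) = _
        rw [IsScalarTower.algebraMap_apply k B B[X], ← C_eq_algebraMap, eval₂_C]
        exact φ.hom.commutes r }

theorem polyEval_hom_apply {B D : CommAlgCat.{u} k} (φ : B ⟶ D) (d : D) (p : B[X]) :
    (polyEval φ d).hom p = eval₂ (φ.hom : B →+* D) d p := rfl

theorem polyEval_X {B D : CommAlgCat.{u} k} (φ : B ⟶ D) (d : D) :
    (polyEval φ d).hom (X : B[X]) = d := eval₂_X _ _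

theorem polyC_comp_polyEval {B D : CommAlgCat.{u} k} (φ : B ⟶ D) (d : D) :
    polyC B ≫ polyEval φ d = φ := by
  ext b
  exact eval₂_C (φ.hom : B →+* D) d

/-- The sum of the coefficients of a polynomial, weighted by scalars. -/
noncomputable def weightedSum (θ : ℕ → k) (B : CommAlgCat.{u} k) : B[X] →ₗ[k] B :=
  lsum fun n => θ n • LinearMap.id

theorem weightedSum_monomial (θ : ℕ → k) (B : CommAlgCat.{u} k) (n : ℕ) (b : B) :
    weightedSum θ B (monomial n b) = θ n • b := by
  simp [weightedSum, sum_monomial_index]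

theorem weightedSum_add (θ η : ℕ → k) (B : CommAlgCat.{u} k) (p : B[X]) :
    weightedSum (θ + η) B p = weightedSum θ B p + weightedSum η B p := by
  induction p using Polynomial.induction_on' with
  | add p q hp hq => rw [map_add, map_add, map_add, hp, hq, add_add_add_comm]
  | monomial n b => simp only [weightedSum_monomial, Pi.add_apply, add_smul]

theorem weightedSum_one (B : CommAlgCat.{u} k) (p : B[X]) :
    weightedSum 1 B p = (polyEval (𝟙 B) 1).hom p := by
  induction p using Polynomial.induction_on' with
  | add p q hp hq => rw [map_add, map_add, hp, hq]
  | monomial n b =>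
    rw [polyEval_hom_apply, eval₂_monomial, weightedSum_monomial, one_pow, mul_one]
    exact one_smul k b

theorem weightedSum_naturality (θ : ℕ → k) {B D : CommAlgCat.{u} k} (φ : B ⟶ D) (p : B[X]) :
    weightedSum θ D ((polyEval (φ ≫ polyC D) (X : D[X])).hom p) = φ.hom (weightedSum θ B p) := by
  induction p using Polynomial.induction_on' with
  | add p q hp hq => rw [map_add, map_add, map_add, map_add, hp, hq]
  | monomial n b =>
    rw [polyEval_hom_apply, eval₂_monomial, weightedSum_monomial, map_smul,
      ← weightedSum_monomial, ← C_mul_X_pow_eq_monomial]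
    rfl

theorem polyEval_scale_monomial (B : CommAlgCat.{u} k) (n : ℕ) (b : B) :
    (polyEval (polyC B) (X + X : B[X])).hom (monomial n b) = monomial n ((2 : k) ^ n • b) := by
  rw [polyEval_hom_apply, eval₂_monomial]
  change C b * (X + X) ^ n = _
  rw [← two_mul, mul_pow, ← C_mul_X_pow_eq_monomial, Algebra.smul_def, map_pow, map_ofNat,
    C_mul, C_pow, map_ofNat]
  ring

theorem weightedSum_scale (θ : ℕ → k) (B : CommAlgCat.{u} k) (p : B[X]) :
    weightedSum θ B ((polyEval (polyC B) (X + X : B[X])).hom p) =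
      weightedSum (fun n => 2 ^ n * θ n) B p := by
  induction p using Polynomial.induction_on' with
  | add p q hp hq => rw [map_add, map_add, map_add, hp, hq]
  | monomial n b =>
    rw [polyEval_scale_monomial, weightedSum_monomial, weightedSum_monomial, smul_smul, mul_comm]

theorem coeff_scale (B : CommAlgCat.{u} k) (p : B[X]) (n : ℕ) :
    ((polyEval (polyC B) (X + X : B[X])).hom p : B[X]).coeff n = (2 : k) ^ n • p.coeff n := by
  induction p using Polynomial.induction_on' with
  | add p q hp hq =>
    rw [map_add]
    refine (coeff_add _ _ _).trans ?_
    rw [hp, hq, coeff_add, smul_add]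
  | monomial m b =>
    rw [polyEval_scale_monomial, coeff_monomial, coeff_monomial]
    split_ifs with h
    · rw [h]
    · rw [smul_zero]

theorem two_sub_two_pow_ne_zero [CharZero k] {n : ℕ} (hn : n ≠ 1) : (2 : k) - 2 ^ n ≠ 0 := by
  rw [sub_ne_zero]
  intro h
  have h' : (2 : ℕ) ^ 1 = 2 ^ n := by exact_mod_cast h
  exact hn (Nat.pow_right_injective le_rfl h').symm

/-- Comparing coefficients in `p(2X) = 2 p(X)` gives `(2 - 2^n) pₙ = 0`, so only degree one
survives, and its coefficient is `p(1)`. -/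
theorem eq_X_mul_of_scale [CharZero k] (B : CommAlgCat.{u} k) (p : B[X])
    (h : (polyEval (polyC B) (X + X : B[X])).hom p = p + p) :
    p = X * C ((polyEval (𝟙 B) 1).hom p) := by
  have h₀ (n : ℕ) (hn : n ≠ 1) : p.coeff n = 0 := by
    have h₁ := coeff_scale B p n
    rw [h, coeff_add, ← two_smul k, ← sub_eq_zero, ← sub_smul] at h₁
    refine (smul_eq_zero_iff_right (two_sub_two_pow_ne_zero hn)).1 h₁
  have h₁ : p = X * C (p.coeff 1) := by
    ext n
    by_cases hn : n = 1
    · subst hn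
      simp
    · rw [h₀ n hn, mul_comm, coeff_C_mul_X, if_neg hn]
  have h₂ : (polyEval (𝟙 B) 1).hom p = p.coeff 1 := by
    rw [h₁, map_mul, polyEval_X, one_mul, coeff_X_mul, coeff_C_zero]
    exact eval₂_C _ _
  rw [h₂]
  exact h₁

/-- Multiplication by a scalar on `𝔾ₐ^ι`. -/
noncomputable def gaSmul {ι : Type} {B : CommAlgCat.{u} k} (b : B) :
    (gaPow k ι).obj B →+ (gaPow k ι).obj B :=
  DistribSMul.toAddMonoidHom (ι →₀ B) b

theorem map_gaSmul {ι : Type} {B D : CommAlgCat.{u} k} (φ : B ⟶ D) (b : B)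
    (x : (gaPow k ι).obj B) :
    (gaPow k ι).map φ (gaSmul b x) = gaSmul (φ.hom b) ((gaPow k ι).map φ x) :=
  Finsupp.ext fun _ => map_mul φ.hom b _

theorem gaSmul_add {ι : Type} {B : CommAlgCat.{u} k} (b c : B) (x : (gaPow k ι).obj B) :
    gaSmul (b + c) x = gaSmul b x + gaSmul c x :=
  add_smul (M := ι →₀ B) b c x

theorem gaSmul_one {ι : Type} {B : CommAlgCat.{u} k} (x : (gaPow k ι).obj B) :
    gaSmul 1 x = x :=
  one_smul (M := B) (α := ι →₀ B) x

theorem gaSmul_zero {ι : Type} {B : CommAlgCat.{u} k} (x : (gaPow k ι).obj B) :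
    gaSmul 0 x = 0 :=
  zero_smul (M₀ := B) (A := ι →₀ B) x

/-- The generic multiple of a point of `𝔾ₐ^ι`. -/
noncomputable def genericMultiple {ι : Type} {B : CommAlgCat.{u} k} (x : (gaPow k ι).obj B) :
    (gaPow k ι).obj (poly B) :=
  gaSmul (X : B[X]) ((gaPow k ι).map (polyC B) x)

theorem map_polyEval_genericMultiple {ι : Type} {B D : CommAlgCat.{u} k} (φ : B ⟶ D) (d : D)
    (x : (gaPow k ι).obj B) :
    (gaPow k ι).map (polyEval φ d) (genericMultiple x) = gaSmul d ((gaPow k ι).map φ x) := by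
  rw [genericMultiple, map_gaSmul, polyEval_X, ← ConcreteCategory.comp_apply, ← Functor.map_comp,
    polyC_comp_polyEval]

theorem map_polyEval_one_genericMultiple {ι : Type} {B : CommAlgCat.{u} k}
    (x : (gaPow k ι).obj B) :
    (gaPow k ι).map (polyEval (𝟙 B) 1) (genericMultiple x) = x := by
  rw [map_polyEval_genericMultiple, gaSmul_one, CategoryTheory.Functor.map_id]
  rfl

theorem map_scale_genericMultiple {ι : Type} {B : CommAlgCat.{u} k}
    (x : (gaPow k ι).obj B) :
    (gaPow k ι).map (polyEval (polyC B) (X + X : B[X])) (genericMultiple x) =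
      genericMultiple (x + x) := by
  rw [map_polyEval_genericMultiple]
  refine (gaSmul_add (B := poly B) X X _).trans ?_
  rw [genericMultiple, map_add, map_add]

theorem map_genericMultiple {ι : Type} {B D : CommAlgCat.{u} k} (φ : B ⟶ D)
    (x : (gaPow k ι).obj B) :
    (gaPow k ι).map (polyEval (φ ≫ polyC D) (X : D[X])) (genericMultiple x) =
      genericMultiple ((gaPow k ι).map φ x) := by
  rw [map_polyEval_genericMultiple, Functor.map_comp, genericMultiple]
  rfl

/-- The weighted sum of coefficients, applied to each coordinate. -/
noncomputable def gaWeightedSum {ι : Type} (θ : ℕ → k) (B : CommAlgCat.{u} k) :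
    (gaPow k ι).obj (poly B) →+ (gaPow k ι).obj B :=
  Finsupp.mapRange.addMonoidHom (weightedSum θ B).toAddMonoidHom

theorem gaWeightedSum_add {ι : Type} (θ η : ℕ → k) (B : CommAlgCat.{u} k)
    (p : (gaPow k ι).obj (poly B)) :
    gaWeightedSum (θ + η) B p = gaWeightedSum θ B p + gaWeightedSum η B p :=
  Finsupp.ext fun _ => weightedSum_add θ η B _

theorem gaWeightedSum_one {ι : Type} (B : CommAlgCat.{u} k) (p : (gaPow k ι).obj (poly B)) :
    gaWeightedSum 1 B p = (gaPow k ι).map (polyEval (𝟙 B) 1) p :=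
  Finsupp.ext fun _ => weightedSum_one B _

theorem gaWeightedSum_naturality {ι : Type} (θ : ℕ → k) {B D : CommAlgCat.{u} k} (φ : B ⟶ D)
    (p : (gaPow k ι).obj (poly B)) :
    gaWeightedSum θ D ((gaPow k ι).map (polyEval (φ ≫ polyC D) (X : D[X])) p) =
      (gaPow k ι).map φ (gaWeightedSum θ B p) :=
  Finsupp.ext fun _ => weightedSum_naturality θ φ _

theorem gaWeightedSum_scale {ι : Type} (θ : ℕ → k) (B : CommAlgCat.{u} k)
    (p : (gaPow k ι).obj (poly B)) :
    gaWeightedSum θ B ((gaPow k ι).map (polyEval (polyC B) (X + X : B[X])) p) =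
      gaWeightedSum (fun n => 2 ^ n * θ n) B p :=
  Finsupp.ext fun _ => weightedSum_scale θ B _

theorem eq_gaSmul_X_of_scale [CharZero k] {ι : Type} (B : CommAlgCat.{u} k)
    (p : (gaPow k ι).obj (poly B))
    (h : (gaPow k ι).map (polyEval (polyC B) (X + X : B[X])) p = p + p) :
    p = gaSmul (X : B[X])
      ((gaPow k ι).map (polyC B) ((gaPow k ι).map (polyEval (𝟙 B) 1) p)) :=
  Finsupp.ext fun i => eq_X_mul_of_scale B _ (DFunLike.congr_fun (F := ι →₀ B[X]) h i)

/-- Expand `v(Xx)` in powers of `X`. Passing from `x` to `2x` multiplies the part of weight `n` by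
`2^n`, so all of `v` except its weight-one part `w` has the form `2 s(x) - s(2x)`. -/
theorem exists_homogeneous_correction [CharZero k] {ι β : Type}
    (v : ∀ B : CommAlgCat.{u} k, (gaPow k ι).obj B → (gaPow k β).obj B)
    (hv : ∀ {B C : CommAlgCat.{u} k} (φ : B ⟶ C) x,
      v C ((gaPow k ι).map φ x) = (gaPow k β).map φ (v B x)) :
    ∃ s w : ∀ B : CommAlgCat.{u} k, (gaPow k ι).obj B → (gaPow k β).obj B,
      (∀ {B C : CommAlgCat.{u} k} (φ : B ⟶ C) x,
        s C ((gaPow k ι).map φ x) = (gaPow k β).map φ (s B x)) ∧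
      (∀ {B C : CommAlgCat.{u} k} (φ : B ⟶ C) x,
        w C ((gaPow k ι).map φ x) = (gaPow k β).map φ (w B x)) ∧
      (∀ B x, v B x + s B (x + x) = w B x + (s B x + s B x)) ∧
      ∀ B x, w B (x + x) = w B x + w B x := by
  classical
  have hnat (θ : ℕ → k) {B C : CommAlgCat.{u} k} (φ : B ⟶ C) (x : (gaPow k ι).obj B) :
      gaWeightedSum θ C (v (poly C) (genericMultiple ((gaPow k ι).map φ x))) =
        (gaPow k β).map φ (gaWeightedSum θ B (v (poly B) (genericMultiple x))) := by
    rw [← map_genericMultiple, hv, gaWeightedSum_naturality]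
  have hdbl (θ : ℕ → k) (B : CommAlgCat.{u} k) (x : (gaPow k ι).obj B) :
      gaWeightedSum θ B (v (poly B) (genericMultiple (x + x))) =
        gaWeightedSum (fun n => 2 ^ n * θ n) B (v (poly B) (genericMultiple x)) := by
    rw [← map_scale_genericMultiple, hv, gaWeightedSum_scale]
  -- The weight-`n` part of the required identity reads `1 + 2^n θₙ = δₙ + 2 θₙ`.
  let θ : ℕ → k := fun n => if n = 1 then 0 else (2 - 2 ^ n)⁻¹
  let δ : ℕ → k := fun n => if n = 1 then 1 else 0
  refine ⟨fun B x => gaWeightedSum θ B (v (poly B) (genericMultiple x)),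
    fun B x => gaWeightedSum δ B (v (poly B) (genericMultiple x)), hnat θ, hnat δ,
    fun B x => ?_, fun B x => ?_⟩
  · have h1 : v B x = gaWeightedSum 1 B (v (poly B) (genericMultiple x)) := by
      rw [gaWeightedSum_one, ← hv, map_polyEval_one_genericMultiple]
    beta_reduce
    rw [hdbl, h1, ← gaWeightedSum_add, ← gaWeightedSum_add, ← gaWeightedSum_add]
    congr 2
    funext n
    simp only [Pi.add_apply, Pi.one_apply, θ, δ]
    split_ifs with hn
    · simp
    · have := two_sub_two_pow_ne_zero (k := k) hn
      field_simp
      ring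
  · beta_reduce
    rw [hdbl, ← gaWeightedSum_add]
    congr 2
    funext n
    simp only [Pi.add_apply, δ]
    split_ifs with hn
    · rw [hn]
      norm_num
    · simp

/-- A polynomial in two variables which vanishes on the axes has no linear term on the diagonal. -/
theorem coeff_one_eval_X_eq_zero {R : Type*} [CommRing R] (p : R[X][X]) (h₀ : p.coeff 0 = 0)
    (h₁ : ∀ j, (p.coeff j).coeff 0 = 0) : (eval X p).coeff 1 = 0 := by
  rw [eval_eq_sum, sum_def, finsetSum_coeff]
  refine Finset.sum_eq_zero fun j _ => ?_
  rw [coeff_mul_X_pow']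
  split_ifs with hj
  · interval_cases j
    · rw [h₀, coeff_zero]
    · exact h₁ 1
  · rfl

variable {ι β : Type} (c : ∀ B : CommAlgCat.{u} k,
    (gaPow k ι).obj B → (gaPow k ι).obj B → (gaPow k β).obj B)
  (hc : ∀ {B C : CommAlgCat.{u} k} (φ : B ⟶ C) x y,
    c C ((gaPow k ι).map φ x) ((gaPow k ι).map φ y) = (gaPow k β).map φ (c B x y))
  (h₂ : ∀ B x y, c B (x + x) (y + y) = c B x y + c B x y)

include hc h₂

/-- Compatibility with doubling already forces compatibility with every scalar, by
`eq_X_mul_of_scale`. -/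
theorem map_genericMultiple_of_homogeneous [CharZero k] {B : CommAlgCat.{u} k}
    (x y : (gaPow k ι).obj B) :
    c (poly B) (genericMultiple x) (genericMultiple y) = genericMultiple (c B x y) := by
  have := eq_gaSmul_X_of_scale B (c (poly B) (genericMultiple x) (genericMultiple y)) (by
    rw [← hc, map_scale_genericMultiple, map_scale_genericMultiple, ← h₂, genericMultiple,
      genericMultiple, genericMultiple, genericMultiple, map_add, map_add, map_add, map_add])
  rw [this, ← hc, map_polyEval_one_genericMultiple, map_polyEval_one_genericMultiple]
  rfl

/-- The polynomial `c(Tx, Sy)` vanishes at `T = 0` and at `S = 0`, so each of its monomials involves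
both variables. On the diagonal it has no linear term, yet homogeneity makes it `T c(x, y)` there.
-/
theorem eq_zero_of_homogeneous [CharZero k] (hl : ∀ B y, c B 0 y = 0) (hr : ∀ B x, c B x 0 = 0)
    (B : CommAlgCat.{u} k) (x y : (gaPow k ι).obj B) : c B x y = 0 := by
  -- The inner variable scales `x` and the outer one scales `y`.
  set p := c (poly (poly B)) ((gaPow k ι).map (polyC _) (genericMultiple x))
    (genericMultiple ((gaPow k ι).map (polyC B) y)) with hp
  have e₁ : (gaPow k β).map (polyEval (𝟙 (poly B)) 0) p = 0 := by
    rw [hp, ← hc, map_polyEval_genericMultiple, gaSmul_zero, hr]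
  have e₂ : (gaPow k β).map (polyEval (polyEval (𝟙 B) 0 ≫ polyC B) (X : B[X])) p = 0 := by
    rw [hp, ← hc, ← ConcreteCategory.comp_apply, ← Functor.map_comp, polyC_comp_polyEval,
      Functor.map_comp, ConcreteCategory.comp_apply, map_polyEval_genericMultiple, gaSmul_zero,
      map_zero, hl]
  have e₃ : (gaPow k β).map (polyEval (𝟙 (poly B)) (X : B[X])) p = genericMultiple (c B x y) := by
    rw [hp, ← hc, map_polyEval_genericMultiple, ← ConcreteCategory.comp_apply,
      ← Functor.map_comp, polyC_comp_polyEval, ← map_genericMultiple_of_homogeneous c hc h₂,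
      CategoryTheory.Functor.map_id]
    rfl
  refine Finsupp.ext fun i => ?_
  let q : B[X][X] := (show β →₀ B[X][X] from p) i
  have f₁ : eval 0 q = 0 := DFunLike.congr_fun (F := β →₀ B[X]) e₁ i
  have f₂ : q.map (evalRingHom 0) = 0 := DFunLike.congr_fun (F := β →₀ B[X]) e₂ i
  have f₃ : eval X q = X * C ((show β →₀ B from c B x y) i) :=
    DFunLike.congr_fun (F := β →₀ B[X]) e₃ i
  have := coeff_one_eval_X_eq_zero q (by rw [coeff_zero_eq_eval_zero, f₁]) (fun j => by
    have := congrArg (fun r : B[X] => r.coeff j) f₂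
    rw [coeff_zero_eq_eval_zero]
    simpa only [coeff_map, coeff_zero, coe_evalRingHom] using this)
  rw [f₃, coeff_X_mul, coeff_C_zero] at this
  exact this

end Polynomials

/-! ### Additive functors in characteristic zero are strictly additive -/

theorem exists_section_of_gaPow [CharZero k] {ι β : Type} [Countable ι]
    (E : Extension (gaPow k ι) (gaPow k β)) : ∃ s : gaPow k ι ⟶ E.obj, s ≫ E.p = 𝟙 _ := by
  have hE := E.shortExact
  have : Epi E.p := hE.epi_g
  obtain ⟨σ, hσ, hpσ⟩ : ∃ σ : ∀ B : CommAlgCat.{u} k, (gaPow k ι).obj B → E.obj.obj B,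
      (∀ {B C : CommAlgCat.{u} k} (φ : B ⟶ C) x,
        σ C ((gaPow k ι).map φ x) = E.obj.map φ (σ B x)) ∧ ∀ B x, E.p.app B (σ B x) = x :=
    (isSetRetractOfGaPow_gaPow ι).exists_lift E.p (fun _ x => x) (fun _ _ => rfl)
  -- The failure of `σ` to commute with doubling; its weight-one part `w` is what the correction by
  -- `s` cannot remove.
  obtain ⟨v, hv, hiv⟩ := exists_preimage_natural hE (X := fun B => (gaPow k ι).obj B)
    (fun φ => (gaPow k ι).map φ) (fun B x => σ B x + σ B x - σ B (x + x))
    (fun φ x => by rw [← map_add, hσ, hσ, ← map_add, ← map_sub])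
    (fun B x => by rw [map_sub, map_add, hpσ, hpσ, sub_self])
  obtain ⟨s, w, hs, hw, hsw, hww⟩ := exists_homogeneous_correction v hv
  have hw0 (B : CommAlgCat.{u} k) : w B 0 = 0 := by
    have := hww B 0
    rwa [add_zero, right_eq_add] at this
  -- The additivity defect of `w` is compatible with doubling and zero on the axes. Once `w` is
  -- additive, it drops out of the doubling law for the additivity defect `c` of `τ`, and the same
  -- vanishing criterion applies to `c`.
  have hwadd (B : CommAlgCat.{u} k) (x y : (gaPow k ι).obj B) :
      w B (x + y) = w B x + w B y := by
    have := eq_zero_of_homogeneous (fun B x y => w B (x + y) - (w B x + w B y))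
      (fun φ x y => by simp only [← map_add, hw, ← map_sub])
      (fun B x y => by
        rw [add_add_add_comm, hww, hww, hww]
        abel)
      (fun B y => by
        rw [hw0, zero_add, zero_add, sub_self])
      (fun B y => by
        rw [hw0, add_zero, add_zero, sub_self]) B x y
    exact sub_eq_zero.1 this
  let τ (B : CommAlgCat.{u} k) (x : (gaPow k ι).obj B) : E.obj.obj B :=
    σ B x - E.i.app B (s B x)
  have hτ {B C : CommAlgCat.{u} k} (φ : B ⟶ C) (x : (gaPow k ι).obj B) :
      τ C ((gaPow k ι).map φ x) = E.obj.map φ (τ B x) := by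
    simp only [τ]
    rw [hσ, hs, NatTrans.naturality_apply, map_sub]
  have hpτ (B : CommAlgCat.{u} k) (x : (gaPow k ι).obj B) : E.p.app B (τ B x) = x := by
    simp only [τ]
    rw [map_sub, hpσ, app_comp_eq_zero ⟨E.i, E.p, E.zero⟩, sub_zero]
  have hττ (B : CommAlgCat.{u} k) (x : (gaPow k ι).obj B) :
      τ B (x + x) = τ B x + τ B x - E.i.app B (w B x) := by
    have e₁ := congrArg (E.i.app B) (hsw B x)
    have e₂ := hiv B x
    simp only [map_add] at e₁
    simp only at e₂
    rw [e₂, ← sub_eq_zero] at e₁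
    simp only [τ]
    rw [← sub_eq_zero, ← neg_eq_zero, ← e₁]
    abel
  have hτ0 (B : CommAlgCat.{u} k) : τ B 0 = 0 := by
    have := hττ B 0
    rwa [add_zero, hw0, map_zero, sub_zero, right_eq_add] at this
  obtain ⟨c, hc, hic⟩ := exists_preimage_natural hE
    (X := fun B => (gaPow k ι).obj B × (gaPow k ι).obj B)
    (fun φ x => ((gaPow k ι).map φ x.1, (gaPow k ι).map φ x.2))
    (fun B x => τ B (x.1 + x.2) - (τ B x.1 + τ B x.2))
    (fun φ x => by simp only [← map_add, hτ, ← map_sub])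
    (fun B x => by simp only [map_sub, map_add, hpτ, sub_self])
  have hc0 (B : CommAlgCat.{u} k) (x y : (gaPow k ι).obj B) : c B (x, y) = 0 := by
    refine eq_zero_of_homogeneous (fun B x y => c B (x, y)) (fun φ x y => hc φ (x, y))
      (fun B x y => ?_) (fun B y => ?_) (fun B x => ?_) B x y
    · apply app_injective hE
      simp only [map_add, hic]
      rw [add_add_add_comm, hττ, hττ, hττ, hwadd, map_add]
      abel
    · apply app_injective hE
      simp only [map_zero, hic]
      rw [hτ0, zero_add, zero_add, sub_self]
    · apply app_injective hE
      simp only [map_zero, hic]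
      rw [hτ0, add_zero, add_zero, sub_self]
  refine ⟨homMk τ (fun B x y => ?_) hτ, ?_⟩
  · have := hic B (x, y)
    rw [hc0, map_zero] at this
    exact sub_eq_zero.1 this.symm
  · ext B x
    exact hpτ B x

/-- The extension with the same middle term and isomorphic outer terms. -/
def extensionOfIso {S : ShortComplex (AbKFunctor k)} (hS : S.ShortExact) {F₁ F₂ : AbKFunctor k}
    (e₁ : S.X₁ ≅ F₂) (e₃ : S.X₃ ≅ F₁) : Extension F₁ F₂ where
  obj := S.X₂
  i := e₁.inv ≫ S.f
  p := S.g ≫ e₃.hom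
  zero := by simp
  shortExact := ShortComplex.shortExact_of_iso
    (ShortComplex.isoMk e₁ (Iso.refl _) e₃ (by simp) (by simp)) hS

theorem exists_section_of_isStrictlyAdditive [CharZero k] {S : ShortComplex (AbKFunctor k)}
    (hS : S.ShortExact) (h₁ : S.X₁.IsStrictlyAdditive) (h₃ : S.X₃.IsStrictlyAdditive) :
    ∃ s : S.X₃ ⟶ S.X₂, s ≫ S.g = 𝟙 _ := by
  obtain ⟨β, _, ⟨e₁⟩⟩ := h₁
  obtain ⟨ι, _, ⟨e₃⟩⟩ := h₃
  obtain ⟨s, hs⟩ := exists_section_of_gaPow (extensionOfIso hS e₁ e₃)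
  obtain ⟨s, hs⟩ : ∃ s : gaPow k ι ⟶ S.X₂, s ≫ S.g ≫ e₃.hom = 𝟙 _ := ⟨s, hs⟩
  refine ⟨e₃.hom ≫ s, ?_⟩
  rw [← cancel_mono e₃.hom, Category.assoc, Category.assoc, hs]
  simp

/-- Extension by zero along an injective map of index sets. -/
noncomputable def gaPowExtend {β κ : Type} (f : β ↪ κ) : gaPow k β ⟶ gaPow k κ :=
  homMk (fun B x => Finsupp.embDomain (M := B) f x)
    (fun B => (Finsupp.embDomain.addMonoidHom (M := B) f).map_add)
    (fun φ x => Finsupp.embDomain_mapRange f φ.hom x (map_zero φ.hom))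

/-- Restriction along an injective map of index sets. -/
noncomputable def gaPowRestrict {β κ : Type} (f : β ↪ κ) : gaPow k κ ⟶ gaPow k β :=
  homMk (fun B x => Finsupp.comapDomain (M := B) f x f.injective.injOn)
    (fun _ _ _ => Finsupp.ext fun _ => rfl) (fun _ _ => Finsupp.ext fun _ => rfl)

theorem gaPowExtend_restrict {β κ : Type} (f : β ↪ κ) :
    gaPowExtend (k := k) f ≫ gaPowRestrict f = 𝟙 _ := by
  ext B x
  exact Finsupp.ext fun i => Finsupp.embDomain_apply_self (M := B) f x i

theorem gaPowExtend_restrict_eq_zero {β ι κ : Type} (f : β ↪ κ) (g : ι ↪ κ)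
    (h : ∀ i, g i ∉ Set.range f) : gaPowExtend (k := k) f ≫ gaPowRestrict g = 0 := by
  ext B x
  exact Finsupp.ext fun i => Finsupp.embDomain_of_notMem_range (M := B) f x _ (h i)

/-- `𝔾ₐ^β ⊕ 𝔾ₐ^ι` is `𝔾ₐ^(β ⊕ ι)`. -/
noncomputable def gaPowBiprodIso (β ι : Type) : gaPow k β ⊞ gaPow k ι ≅ gaPow k (β ⊕ ι) :=
  Iso.symm <| ShortComplex.Splitting.isoBinaryBiproduct
    (S := .mk (gaPowExtend (k := k) (Function.Embedding.inl (α := β) (β := ι)))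
      (gaPowRestrict Function.Embedding.inr)
      (gaPowExtend_restrict_eq_zero _ _ (by simp)))
    { r := gaPowRestrict Function.Embedding.inl
      s := gaPowExtend Function.Embedding.inr
      f_r := gaPowExtend_restrict _
      s_g := gaPowExtend_restrict _
      id := by
        ext B x
        refine Finsupp.ext (M := B) fun i => ?_
        change Finsupp.embDomain (M := B) _ _ i + Finsupp.embDomain (M := B) _ _ i = _
        obtain i | i := i
        · refine (congrArg₂ (· + ·) (Finsupp.embDomain_apply_self (M := B) .inl _ i)
            (Finsupp.embDomain_of_notMem_range (M := B) .inr _ _ (by simp))).trans ?_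
          exact add_zero _
        · refine (congrArg₂ (· + ·)
            (Finsupp.embDomain_of_notMem_range (M := B) .inl _ _ (by simp))
            (Finsupp.embDomain_apply_self (M := B) .inr _ i)).trans ?_
          exact zero_add _ }

/-- The sequence splits, and a direct sum of two countable powers of `𝔾ₐ` is again one. This
collapses a filtration step by step. -/
theorem isStrictlyAdditive_of_shortExact [CharZero k] {S : ShortComplex (AbKFunctor k)}
    (hS : S.ShortExact) (h₁ : S.X₁.IsStrictlyAdditive) (h₃ : S.X₃.IsStrictlyAdditive) :
    S.X₂.IsStrictlyAdditive := by
  obtain ⟨s, hs⟩ := exists_section_of_isStrictlyAdditive hS h₁ h₃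
  have e := (ShortComplex.Splitting.ofExactOfSection _ hS.exact s hs hS.mono_f).isoBinaryBiproduct
  obtain ⟨β, _, ⟨e₁⟩⟩ := h₁
  obtain ⟨ι, _, ⟨e₃⟩⟩ := h₃
  exact ⟨β ⊕ ι, inferInstance, ⟨e ≪≫ biprod.mapIso e₁ e₃ ≪≫ gaPowBiprodIso β ι⟩⟩

theorem IsAdditive.isStrictlyAdditive [CharZero k] {V : AbKFunctor k} (hV : V.IsAdditive) :
    V.IsStrictlyAdditive :=
  hV.induction (fun _ => isStrictlyAdditive_of_isZero)
    (fun e ⟨ι, hι, ⟨e'⟩⟩ => ⟨ι, hι, ⟨e.symm ≪≫ e'⟩⟩)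
    (fun _ hS h₁ h₃ => isStrictlyAdditive_of_shortExact hS h₁ h₃)

theorem IsAdditive.extOneVanishes [CharZero k] {U V : AbKFunctor k} (hU : U.IsAdditive)
    (hV : V.IsAdditive) : ExtOneVanishes U V :=
  extOneVanishes_of_section fun E => exists_section_of_isStrictlyAdditive E.shortExact
    hV.isStrictlyAdditive hU.isStrictlyAdditive

theorem map_comp_apply (F : AbKFunctor k) {A B C : CommAlgCat.{u} k} (φ : A ⟶ B) (ψ : B ⟶ C)
    (x : F.obj A) : F.map (φ ≫ ψ) x = F.map ψ (F.map φ x) := by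
  rw [Functor.map_comp, ConcreteCategory.comp_apply]

/-! ### Split algebras and their idempotents -/

section Split

variable (k) in
/-- The split algebra `k^J`. -/
abbrev splitAlg (J : Type) : CommAlgCat.{u} k := .of k (J → k)

variable (k) in
/-- The base field as a `k`-algebra. -/
abbrev baseAlg : CommAlgCat.{u} k := .of k k

/-- The projections of a split algebra. -/
def splitEval {J : Type} (j : J) : splitAlg k J ⟶ baseAlg k :=
  CommAlgCat.ofHom (Pi.evalAlgHom k (fun _ : J => k) j)

/-- Reindexing of split algebras. -/
def splitMap {J J' : Type} (f : J' → J) : splitAlg k J ⟶ splitAlg k J' :=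
  CommAlgCat.ofHom (AlgHom.pi fun j => Pi.evalAlgHom k (fun _ : J => k) (f j))

theorem splitMap_comp_splitEval {J J' : Type} (f : J' → J) (j : J') :
    splitMap f ≫ splitEval (k := k) j = splitEval (f j) := rfl

theorem bijective_map_of_bijective (F : AbKFunctor k) {A B : CommAlgCat.{u} k} (φ : A ⟶ B)
    (h : Function.Bijective φ.hom) : Function.Bijective (F.map φ) := by
  let e : A ≅ B :=
    { hom := φ
      inv := CommAlgCat.ofHom (AlgEquiv.ofBijective φ.hom h).symm.toAlgHom
      hom_inv_id := by
        ext x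
        exact (AlgEquiv.ofBijective φ.hom h).symm_apply_apply x
      inv_hom_id := by
        ext x
        exact (AlgEquiv.ofBijective φ.hom h).apply_symm_apply x }
  have : IsIso φ := e.isIso_hom
  exact ConcreteCategory.bijective_of_isIso _

theorem IsFpqcSheaf.bijective_splitEval {F : AbKFunctor k} (hF : F.IsFpqcSheaf) (J : Type)
    [Finite J] :
    Function.Bijective fun (x : F.obj (splitAlg k J)) (j : J) => F.map (splitEval j) x := by
  induction J using Finite.induction_empty_option with
  | of_equiv e h =>
    rename_i α β
    have h₁ := F.bijective_map_of_bijective (splitMap (k := k) e)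
      (Equiv.arrowCongr e.symm (Equiv.refl k)).bijective
    convert! (Equiv.arrowCongr e (Equiv.refl (F.obj (baseAlg k)))).bijective.comp
      (h.comp h₁) using 1
    funext x b
    simp [← map_comp_apply, splitMap_comp_splitEval]
  | h_empty =>
    have h₁ : Subsingleton (F.obj (splitAlg k PEmpty)) := hF.subsingleton _ inferInstance
    exact ⟨fun x y _ => Subsingleton.elim x y, fun y => ⟨0, Subsingleton.elim _ _⟩⟩
  | h_option h =>
    rename_i α _
    let ψ : splitAlg k (Option α) ⟶ .of k (k × (α → k)) :=
      CommAlgCat.ofHom ((splitEval none).hom.prod (splitMap some).hom)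
    have h₁ := F.bijective_map_of_bijective ψ
      (Equiv.piOptionEquivProd (β := fun _ => k)).bijective
    convert! (Equiv.piOptionEquivProd (β := fun _ => F.obj (baseAlg k))).symm.bijective.comp
      ((Function.bijective_id.prodMap h).comp ((hF.prod k (α → k)).comp h₁)) using 1
    funext x a
    cases a with
    | none => exact F.map_comp_apply ψ (CommAlgCat.ofHom (AlgHom.fst k k (α → k))) x
    | some a =>
      exact (F.map_comp_apply ψ
        (CommAlgCat.ofHom (AlgHom.snd k k (α → k)) ≫ splitEval a) x).trans
        (F.map_comp_apply _ _ _)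

theorem isIdempotentElem_apply_single {J : Type} [DecidableEq J]
    {B : Type*} [CommRing B] [Algebra k B]
    (φ : (J → k) →ₐ[k] B) (j : J) : IsIdempotentElem (φ (Pi.single j 1)) := by
  rw [IsIdempotentElem, ← map_mul, ← Pi.single_mul, one_mul]

/-- A point of `Spec B` at which the `j`-th idempotent is nonzero lies over the `j`-th point of
`Spec k^J`. -/
theorem comap_eq_comap_splitEval {J : Type} [DecidableEq J] {B : CommAlgCat.{u} k}
    (φ : splitAlg k J ⟶ B)
    (P : PrimeSpectrum B) (j : J) (h : φ.hom (Pi.single j 1) ∉ P.asIdeal) :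
    PrimeSpectrum.comap (φ.hom : (J → k) →+* B) P =
      PrimeSpectrum.comap ((splitEval (k := k) j).hom : (J → k) →+* k)
        ⟨⊥, Ideal.isPrime_bot⟩ := by
  ext x
  change φ.hom x ∈ P.asIdeal ↔ x j = 0
  have hx : x * Pi.single j 1 = Pi.single j (x j) := by
    ext i
    by_cases hi : i = j
    · subst hi
      simp
    · simp [hi]
  constructor
  · intro hP
    by_contra hj
    apply h
    have : (Pi.single j 1 : J → k) = x * Pi.single j (x j)⁻¹ := by
      ext i
      by_cases hi : i = j
      · subst hi
        simp [hj]
      · simp [hi]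
    rw [this, map_mul]
    exact P.asIdeal.mul_mem_right _ hP
  · intro hj
    refine (P.isPrime.mem_or_mem (x := φ.hom x) (y := φ.hom (Pi.single j 1)) ?_).resolve_right h
    rw [← map_mul, hx, hj, Pi.single_zero, map_zero]
    exact zero_mem _

variable {J : Type} [Fintype J] [DecidableEq J]

theorem apply_eq_sum_single {B : Type*} [CommRing B] [Algebra k B] (φ : (J → k) →ₐ[k] B)
    (x : J → k) : φ x = ∑ j, x j • φ (Pi.single j 1) := by
  conv_lhs => rw [pi_eq_sum_univ' x]
  simp [map_sum, map_smul]

theorem sum_apply_single {B : Type*} [CommRing B] [Algebra k B] (φ : (J → k) →ₐ[k] B) :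
    ∑ j, φ (Pi.single j 1) = 1 := by
  rw [← map_one φ, apply_eq_sum_single]
  simp

/-- The homomorphism given by a complete family of orthogonal idempotents. -/
def splitLift {B : Type*} [CommRing B] [Algebra k B] {ε : J → B}
    (hε : CompleteOrthogonalIdempotents ε) : (J → k) →ₐ[k] B :=
  AlgHom.ofLinearMap (Fintype.linearCombination k ε)
    (by simp [Fintype.linearCombination_apply, hε.complete])
    (fun x y => by
      simp [Fintype.linearCombination_apply, Finset.mul_sum, hε.mul_eq, smul_smul, mul_comm])

theorem splitLift_apply {B : Type*} [CommRing B] [Algebra k B] {ε : J → B}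
    (hε : CompleteOrthogonalIdempotents ε) (x : J → k) : splitLift hε x = ∑ j, x j • ε j := rfl

theorem splitLift_single {B : Type*} [CommRing B] [Algebra k B] {ε : J → B}
    (hε : CompleteOrthogonalIdempotents ε) (j : J) :
    splitLift (k := k) hε (Pi.single j 1) = ε j := by
  simp [splitLift_apply, Pi.single_apply]

theorem exists_single_notMem {B : CommAlgCat.{u} k} (φ : splitAlg k J ⟶ B)
    (P : PrimeSpectrum B) : ∃ j, φ.hom (Pi.single j 1) ∉ P.asIdeal := by
  by_contra! h
  apply P.isPrime.ne_top
  rw [Ideal.eq_top_iff_one, ← sum_apply_single φ.hom]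
  exact sum_mem fun j _ => h j

end Split

/-! ### Constant sheaves on split algebras -/

section Values

variable {A : Type u} [AddCommGroup A]

/-- The value at a point of a section of a constant sheaf. -/
def valueAt {B : CommAlgCat.{u} k} (x : (constSheaf k A).obj B) (P : PrimeSpectrum B) : A :=
  DFunLike.coe (F := LocallyConstant (PrimeSpectrum B) A) x P

theorem valueAt_ext {B : CommAlgCat.{u} k} {x y : (constSheaf k A).obj B}
    (h : ∀ P, valueAt x P = valueAt y P) : x = y := LocallyConstant.ext h

theorem valueAt_zero {B : CommAlgCat.{u} k} (P : PrimeSpectrum B) :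
    valueAt (0 : (constSheaf k A).obj B) P = 0 := rfl

theorem valueAt_zsmul {B : CommAlgCat.{u} k} (n : ℤ) (x : (constSheaf k A).obj B)
    (P : PrimeSpectrum B) : valueAt (n • x) P = n • valueAt x P := rfl

theorem valueAt_map {B C : CommAlgCat.{u} k} (φ : B ⟶ C) (x : (constSheaf k A).obj B)
    (P : PrimeSpectrum C) :
    valueAt ((constSheaf k A).map φ x) P =
      valueAt x (PrimeSpectrum.comap (φ.hom : B →+* C) P) := rfl

theorem valueAt_map_split {J : Type} [DecidableEq J] {B : CommAlgCat.{u} k}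
    (φ : splitAlg k J ⟶ B)
    (x : (constSheaf k A).obj (splitAlg k J)) (P : PrimeSpectrum B) (j : J)
    (h : φ.hom (Pi.single j 1) ∉ P.asIdeal) :
    valueAt ((constSheaf k A).map φ x) P =
      valueAt ((constSheaf k A).map (splitEval j) x) ⟨⊥, Ideal.isPrime_bot⟩ := by
  rw [valueAt_map, comap_eq_comap_splitEval φ P j h, valueAt_map]

variable {J : Type} [Fintype J] [DecidableEq J]

theorem constSheaf_splitAlg_ext {x y : (constSheaf k A).obj (splitAlg k J)}
    (h : ∀ j, (constSheaf k A).map (splitEval j) x = (constSheaf k A).map (splitEval j) y) :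
    x = y := by
  refine valueAt_ext fun P => ?_
  obtain ⟨j, hj⟩ := exists_single_notMem (𝟙 (splitAlg k J)) P
  have hx := valueAt_map_split (𝟙 (splitAlg k J)) x P j hj
  have hy := valueAt_map_split (𝟙 (splitAlg k J)) y P j hj
  exact hx.trans ((congrArg (valueAt · _) (h j)).trans hy.symm)

theorem exists_constSheaf_splitAlg (a : J → (constSheaf k A).obj (baseAlg k)) :
    ∃ x : (constSheaf k A).obj (splitAlg k J), ∀ j, (constSheaf k A).map (splitEval j) x = a j := by
  choose i hi using exists_single_notMem (𝟙 (splitAlg k J))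
  let x : LocallyConstant (PrimeSpectrum (J → k)) A :=
    ⟨fun P => valueAt (a (i P)) ⟨⊥, Ideal.isPrime_bot⟩, IsLocallyConstant.of_discrete _⟩
  refine ⟨x, fun j => valueAt_ext fun P => ?_⟩
  have hP : P = ⟨⊥, Ideal.isPrime_bot⟩ := Subsingleton.elim (α := PrimeSpectrum k) _ _
  subst hP
  change valueAt (a (i _)) _ = _
  congr 2
  have := hi (PrimeSpectrum.comap ((splitEval (k := k) j).hom : (J → k) →+* k)
    ⟨⊥, Ideal.isPrime_bot⟩)
  by_contra hij
  apply this
  change (Pi.single (i _) (1 : k) : J → k) j = 0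
  exact Pi.single_eq_of_ne' hij 1

end Values

/-! ### Extensions of the constant sheaf `ℤ` -/

section Integers

variable {F : AbKFunctor k} {E : Extension (constSheaf k (ULift.{u} ℤ)) F}

/-- With `exists_extension_splitAlg`, this is the five lemma for `E(k^J) → E(k)^J`: both outer terms
of the extension turn `k^J` into a product. -/
theorem extension_splitAlg_ext (hF : F.IsFpqcSheaf) {J : Type} [Finite J]
    {x y : E.obj.obj (splitAlg k J)}
    (h : ∀ j, E.obj.map (splitEval j) x = E.obj.map (splitEval j) y) : x = y := by
  classical
  have := Fintype.ofFinite J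
  rw [← sub_eq_zero]
  have hxy (j : J) : E.obj.map (splitEval j) (x - y) = 0 := by rw [map_sub, h, sub_self]
  obtain ⟨f, hf⟩ := app_exact E.shortExact (x := x - y) (constSheaf_splitAlg_ext fun j => by
    rw [← NatTrans.naturality_apply, hxy, map_zero, map_zero])
  have hf0 : f = 0 := (hF.bijective_splitEval J).1 (funext fun j => by
    apply app_injective E.shortExact
    beta_reduce
    rw [NatTrans.naturality_apply, hf, hxy, map_zero, map_zero])
  rw [← hf, hf0, map_zero]

theorem exists_extension_splitAlg (hF : F.IsFpqcSheaf) {J : Type} [Finite J]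
    (a : J → E.obj.obj (baseAlg k)) :
    ∃ x : E.obj.obj (splitAlg k J), ∀ j, E.obj.map (splitEval j) x = a j := by
  classical
  have := Fintype.ofFinite J
  obtain ⟨z, hz⟩ := exists_constSheaf_splitAlg fun j => E.p.app _ (a j)
  obtain ⟨y, rfl⟩ := app_surjective E.shortExact _ z
  choose f hf using fun j => app_exact E.shortExact (x := E.obj.map (splitEval j) y - a j) (by
    rw [map_sub, ← hz j, ← NatTrans.naturality_apply, sub_self])
  obtain ⟨g, hg⟩ := (hF.bijective_splitEval J).2 f
  refine ⟨y - E.i.app _ g, fun j => ?_⟩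
  have hgj : F.map (splitEval j) g = f j := congrFun hg j
  rw [map_sub, ← NatTrans.naturality_apply, hgj]
  exact (congrArg _ (hf j)).trans (sub_sub_cancel _ _)

/-- `x ∈ E(B)` is locally a multiple of `e ∈ E(k)`. -/
def IsLocallyMultiple (E : Extension (constSheaf k (ULift.{u} ℤ)) F)
    (e : E.obj.obj (baseAlg k)) (B : CommAlgCat.{u} k) (x : E.obj.obj B) :
    Prop :=
  ∃ (J : Type) (_ : Finite J) (φ : splitAlg k J ⟶ B) (w : E.obj.obj (splitAlg k J)) (a : J → ℤ),
    (∀ j, E.obj.map (splitEval j) w = a j • e) ∧ E.obj.map φ w = x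

variable {e : E.obj.obj (baseAlg k)} {B : CommAlgCat.{u} k}

theorem IsLocallyMultiple.map {x : E.obj.obj B} (hx : IsLocallyMultiple E e B x)
    {C : CommAlgCat.{u} k} (ψ : B ⟶ C) : IsLocallyMultiple E e C (E.obj.map ψ x) := by
  obtain ⟨J, hJ, φ, w, a, hw, rfl⟩ := hx
  exact ⟨J, hJ, φ ≫ ψ, w, a, hw, map_comp_apply _ _ _ _⟩

theorem IsLocallyMultiple.neg {x : E.obj.obj B} (hx : IsLocallyMultiple E e B x) :
    IsLocallyMultiple E e B (-x) := by
  obtain ⟨J, hJ, φ, w, a, hw, rfl⟩ := hx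
  exact ⟨J, hJ, φ, -w, -a, fun j => by rw [map_neg, hw, Pi.neg_apply, neg_smul], map_neg _ _⟩

/-- Two homomorphisms from split algebras factor through a common one. -/
theorem exists_common_split {J J' : Type} [Finite J] [Finite J'] (φ : splitAlg k J ⟶ B)
    (φ' : splitAlg k J' ⟶ B) :
    ∃ ψ : splitAlg k (J × J') ⟶ B, splitMap Prod.fst ≫ ψ = φ ∧ splitMap Prod.snd ≫ ψ = φ' := by
  classical
  have := Fintype.ofFinite J
  have := Fintype.ofFinite J'
  have hε : CompleteOrthogonalIdempotents fun j : J × J' =>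
      φ.hom (Pi.single j.1 1) * φ'.hom (Pi.single j.2 1) := by
    rw [CompleteOrthogonalIdempotents.iff_ortho_complete]
    constructor
    · rintro ⟨i, i'⟩ ⟨j, j'⟩ hij
      rw [mul_mul_mul_comm, ← map_mul, ← map_mul]
      by_cases h : i = j
      · have h' : i' ≠ j' := fun h' => hij (by rw [h, h'])
        rw [(CompleteOrthogonalIdempotents.single fun _ : J' => k).ortho h', map_zero, mul_zero]
      · rw [(CompleteOrthogonalIdempotents.single fun _ : J => k).ortho h, map_zero, zero_mul]
    · rw [Fintype.sum_prod_type]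
      simp_rw [← Finset.mul_sum, sum_apply_single, mul_one, sum_apply_single]
  refine ⟨CommAlgCat.ofHom (splitLift hε), ?_, ?_⟩
  · ext x
    refine (splitLift_apply hε _).trans ?_
    rw [Fintype.sum_prod_type, apply_eq_sum_single φ.hom]
    refine Finset.sum_congr rfl fun j _ => ?_
    change ∑ j', x j • _ = _
    rw [← Finset.smul_sum]
    dsimp only
    rw [← Finset.mul_sum, sum_apply_single, mul_one]
  · ext x
    refine (splitLift_apply hε _).trans ?_
    rw [Fintype.sum_prod_type_right, apply_eq_sum_single φ'.hom]
    refine Finset.sum_congr rfl fun j _ => ?_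
    change ∑ j', x j • _ = _
    rw [← Finset.smul_sum]
    dsimp only
    rw [← Finset.sum_mul, sum_apply_single, one_mul]

theorem IsLocallyMultiple.add {x y : E.obj.obj B} (hx : IsLocallyMultiple E e B x)
    (hy : IsLocallyMultiple E e B y) : IsLocallyMultiple E e B (x + y) := by
  obtain ⟨J, hJ, φ, w, a, hw, rfl⟩ := hx
  obtain ⟨J', hJ', φ', w', a', hw', rfl⟩ := hy
  obtain ⟨ψ, rfl, rfl⟩ := exists_common_split φ φ'
  refine ⟨J × J', inferInstance, ψ,
    E.obj.map (splitMap Prod.fst) w + E.obj.map (splitMap Prod.snd) w',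
    fun j => a j.1 + a' j.2, fun j => ?_, ?_⟩
  · rw [map_add, ← map_comp_apply, ← map_comp_apply, splitMap_comp_splitEval,
      splitMap_comp_splitEval, hw, hw', add_smul]
  · rw [map_add, ← map_comp_apply, ← map_comp_apply]

theorem subsingleton_extension_obj (hF : F.IsFpqcSheaf) (hB : Subsingleton B) :
    Subsingleton (E.obj.obj B) := by
  have := hF.subsingleton B hB
  refine subsingleton_of_forall_eq 0 fun x => ?_
  obtain ⟨f, rfl⟩ := app_exact E.shortExact (x := x) (valueAt_ext fun P =>
    (P.isPrime.ne_top ((Ideal.eq_top_iff_one _).2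
      (Subsingleton.elim (0 : B) 1 ▸ P.asIdeal.zero_mem))).elim)
  have hf : f = 0 := Subsingleton.elim (α := F.obj (CommAlgCat.of k B)) f 0
  rw [hf, map_zero]

/-- At a point of `Spec B` where the `j`-th idempotent is nonzero, the image in `ℤ` has value `a j`,
so `a j = 0`. Indices whose idempotent is zero in `B` carry no information and have to be discarded.
-/
theorem IsLocallyMultiple.eq_zero (hF : F.IsFpqcSheaf) (he : ∀ P, valueAt (E.p.app _ e) P = ⟨1⟩)
    {x : E.obj.obj B}
    (hx : IsLocallyMultiple E e B x) (h0 : E.p.app B x = 0) : x = 0 := by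
  classical
  obtain ⟨J, hJ, φ, w, a, hw, rfl⟩ := hx
  have := Fintype.ofFinite J
  have ha (j : J) (hj : φ.hom (Pi.single j 1) ≠ 0) : a j = 0 := by
    obtain ⟨P, hP⟩ : ∃ P : PrimeSpectrum B, φ.hom (Pi.single j 1) ∉ P.asIdeal := by
      by_contra! h
      refine hj (PrimeSpectrum.basicOpen_injOn_isIdempotentElem
        (isIdempotentElem_apply_single φ.hom j) IsIdempotentElem.zero ?_)
      ext P
      simp [h P]
    have h1 := valueAt_map_split φ (E.p.app _ w) P j hP
    rw [← NatTrans.naturality_apply, ← NatTrans.naturality_apply, h0, hw, map_zsmul,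
      valueAt_zsmul, he, valueAt_zero] at h1
    simpa using (congrArg ULift.down h1).symm
  by_cases hne : ∃ j, φ.hom (Pi.single j 1) ≠ 0
  · obtain ⟨j₀, hj₀⟩ := hne
    -- Redirecting the invisible indices to a visible one leaves `φ` unchanged but makes all
    -- components of `w` zero.
    let r : J → J := fun j => if φ.hom (Pi.single j 1) = 0 then j₀ else j
    have hr : splitMap r ≫ φ = φ := by
      ext x
      change φ.hom (fun j => x (r j)) = φ.hom x
      rw [apply_eq_sum_single φ.hom, apply_eq_sum_single φ.hom x]
      refine Finset.sum_congr rfl fun j _ => ?_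
      simp only [r]
      split_ifs with h
      · rw [h, smul_zero, smul_zero]
      · rfl
    have hrw : E.obj.map (splitMap r) w = 0 := by
      refine extension_splitAlg_ext hF fun j => ?_
      have hj : φ.hom (Pi.single (r j) 1) ≠ 0 := by
        simp only [r]
        split_ifs with h
        · exact hj₀
        · exact h
      rw [← map_comp_apply, splitMap_comp_splitEval, hw, ha _ hj, zero_smul, map_zero]
    rw [← hr, map_comp_apply, hrw, map_zero]
  · push Not at hne
    have h1 : (1 : B) = 0 := by
      rw [← sum_apply_single φ.hom]
      exact Finset.sum_eq_zero fun j _ => hne j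
    have := subsingleton_extension_obj hF (E := E) (subsingleton_of_zero_eq_one h1.symm)
    exact Subsingleton.elim _ _

theorem exists_isLocallyMultiple (hF : F.IsFpqcSheaf) (he : ∀ P, valueAt (E.p.app _ e) P = ⟨1⟩)
    (f : (constSheaf k (ULift.{u} ℤ)).obj B) :
    ∃ x, IsLocallyMultiple E e B x ∧ E.p.app B x = f := by
  classical
  let g : LocallyConstant (PrimeSpectrum B) (ULift.{u} ℤ) := f
  let S : Finset ℤ := g.range_finite.toFinset.image ULift.down
  have hS (P : PrimeSpectrum B) : (g P).down ∈ S :=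
    Finset.mem_image_of_mem _ (g.range_finite.mem_toFinset.2 ⟨P, rfl⟩)
  -- The fibres of `f` are clopen and finitely many are nonempty; their idempotents define a
  -- homomorphism from `k^S` to `B` through which `f` factors.
  choose ε hε hεg using fun n : S =>
    PrimeSpectrum.exists_idempotent_basicOpen_eq_of_isClopen (g.2.isClopen_fiber ⟨n⟩)
  have hmem (n : S) (P : PrimeSpectrum B) : ε n ∉ P.asIdeal ↔ g P = ⟨n⟩ := by
    have : P ∈ {P | g P = ⟨n⟩} ↔ P ∈ (PrimeSpectrum.basicOpen (ε n) : Set (PrimeSpectrum B)) := by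
      rw [← hεg n]
      rfl
    exact this.symm
  have ho : OrthogonalIdempotents ε := by
    refine ⟨hε, fun m n hmn => ?_⟩
    refine PrimeSpectrum.basicOpen_injOn_isIdempotentElem ((hε m).mul (hε n))
      IsIdempotentElem.zero ?_
    ext P
    have h : ε m * ε n ∈ P.asIdeal := by
      by_contra h
      have h₁ := (hmem m P).1 fun h' => h (P.asIdeal.mul_mem_right _ h')
      have h₂ := (hmem n P).1 fun h' => h (P.asIdeal.mul_mem_left _ h')
      exact hmn (Subtype.ext (congrArg ULift.down (h₁.symm.trans h₂)))
    rw [SetLike.mem_coe, SetLike.mem_coe, PrimeSpectrum.mem_basicOpen,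
      PrimeSpectrum.mem_basicOpen]
    exact iff_of_false (not_not_intro h) (not_not_intro P.asIdeal.zero_mem)
  have hc : CompleteOrthogonalIdempotents ε := by
    refine ⟨ho, PrimeSpectrum.basicOpen_injOn_isIdempotentElem ho.isIdempotentElem_sum
      IsIdempotentElem.one ?_⟩
    ext P
    have h : ∑ n, ε n ∉ P.asIdeal := fun h => (hmem ⟨(g P).down, hS P⟩ P).2 rfl (by
      rw [← ho.mul_sum_of_mem (Finset.mem_univ _)]
      exact P.asIdeal.mul_mem_left _ h)
    rw [SetLike.mem_coe, SetLike.mem_coe, PrimeSpectrum.mem_basicOpen,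
      PrimeSpectrum.mem_basicOpen]
    exact iff_of_true h ((Ideal.ne_top_iff_one _).1 P.isPrime.ne_top)
  obtain ⟨w, hw⟩ := exists_extension_splitAlg hF (E := E) fun n : S => (n : ℤ) • e
  let φ : splitAlg k S ⟶ B := CommAlgCat.ofHom (splitLift hc)
  refine ⟨E.obj.map φ w, ⟨S, inferInstance, φ, w, fun n => n, hw, rfl⟩, valueAt_ext fun P => ?_⟩
  have hP : φ.hom (Pi.single ⟨(g P).down, hS P⟩ 1) ∉ P.asIdeal := by
    change splitLift hc _ ∉ _
    rw [splitLift_single, hmem]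
  rw [NatTrans.naturality_apply, valueAt_map_split φ _ P _ hP, ← NatTrans.naturality_apply, hw,
    map_zsmul, valueAt_zsmul, he]
  refine ULift.ext _ _ ?_
  change (g P).down • (1 : ℤ) = (g P).down
  simp

end Integers

/-- The locally-multiple elements form a subfunctor of groups that `E.p` maps isomorphically onto
`ℤ`; the section is the inverse, and `huniq` makes it additive and natural. -/
theorem extOneVanishes_int {F : AbKFunctor k} (hF : F.IsFpqcSheaf) :
    ExtOneVanishes (constSheaf k (ULift.{u} ℤ)) F := by
  refine extOneVanishes_of_section fun E => ?_
  let one : LocallyConstant (PrimeSpectrum k) (ULift.{u} ℤ) := .const _ ⟨1⟩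
  obtain ⟨e, he⟩ := app_surjective E.shortExact (baseAlg k) one
  have he' (P) : valueAt (E.p.app _ e) P = ⟨1⟩ := congrArg (valueAt · P) he
  choose s hs hps using fun B => exists_isLocallyMultiple hF (E := E) (e := e) (B := B) he'
  have huniq {B : CommAlgCat.{u} k} {x y : E.obj.obj B} (hx : IsLocallyMultiple E e B x)
      (hy : IsLocallyMultiple E e B y) (h : E.p.app B x = E.p.app B y) : x = y := by
    rw [← sub_eq_zero]
    refine IsLocallyMultiple.eq_zero hF he' ?_ (by rw [map_sub, h, sub_self])
    rw [sub_eq_add_neg]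
    exact hx.add hy.neg
  refine ⟨homMk s (fun B x y => huniq (hs _ _) ((hs _ _).add (hs _ _)) ?_)
    (fun φ x => huniq (hs _ _) ((hs _ _).map φ) ?_), ?_⟩
  · rw [map_add, hps, hps, hps]
  · rw [NatTrans.naturality_apply, hps, hps]
  · ext B : 3
    exact AddMonoidHom.ext fun x => hps B x

end AbKFunctor

theorem mainTheorem6 (k : Type u) [Field k] :
    (∀ (V W G : AbKFunctor k) (π : W ⟶ G), Epi π → V.IsAdditive →
      Function.Surjective
        (fun σ : V.toSet ⟶ W.toSet => σ ≫ AbKFunctor.mapToSet π)) ∧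
    (∀ V F : AbKFunctor k, V.IsAdditive → extOneSetSplit V F = Set.univ) ∧
    (∀ F : AbKFunctor k, F.IsFpqcSheaf → ExtOneVanishes (constSheaf k (ULift.{u} ℤ)) F) ∧
    (∀ S : ShortComplex (AbKFunctor k), S.ShortExact → S.X₁.IsAdditive → S.X₂.IsAdditive →
      ExtOneVanishes (gm k) S.X₃) ∧
    (∀ I D : AbKFunctor k, I.IsSubnilpotent → D.IsDiscrete → ExtOneVanishes I D) ∧
    (CharZero k → ∀ U V : AbKFunctor k, U.IsAdditive → V.IsAdditive → ExtOneVanishes U V) :=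
  ⟨fun _ _ _ π _ hV => hV.surjective_comp_mapToSet π,
    fun _ F hV => hV.extOneSetSplit_eq_univ F,
    fun _ hF => AbKFunctor.extOneVanishes_int hF,
    fun _ hS h₁ h₂ => AbKFunctor.extOneVanishes_gm_of_shortExact hS h₁ h₂,
    fun _ _ hI hD => hI.extOneVanishes hD,
    fun _ _ _ hU hV => hU.extOneVanishes hV⟩
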